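/- **R(quad).** A quadratic sum over a set of variables is an integer combination $\sum c_{vw}\,vw+\sum c_v\,v+c$ of the monomials of degree at most $2$ (each monomial written once). R(quad) operates with finite disjunctions (sets) of equations $L=a$, with $L$ a quadratic sum and $a\in\mathbb Z$; the size of an equation is the sum of the absolute values of all its coefficients, including $c$ and $a$ (unary coefficients), the size of a disjunction is the sum of the sizes of its equations, and the size of a proof is the sum of the sizes of its lines. For a finite $S\subset\mathbb Z$, $L\in S$ denotes the disjunction $\bigvee_{a\in S}(L=a)$. A refutation of a collection $K$ is a finite sequence of disjunctions, ending in the empty disjunction, in which every line is a member of $K$, or a Boolean axiom $v\in\{0,1\}$, $vw\in\{0,1\}$, $v+w-vw\in\{0,1\}$, $v-vw\in\{0,1\}$ (for variables $v,w$), or follows from earlier lines by one of the rules: from $A\lor L$ and $B\lor M$ derive $A\lor B\lor(L-M)$ (difference of equations); from $A$ derive $A\lor L$; from $A\lor(0=a)$ with $a\ne0$ derive $A$. **The formula $\Upsilon=\Upsilon_{n,m,k,t,d,c}$.** Let $n,m,t\ge0$, $k\ge 0$ even, $d\ge1$, and $c\in\{k,3k\}$. Let the literals be $i\in[2n]$,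 where $i+n$ is the negation of the $i$th variable for $i\in[n]$. The variables are $x_{lhi}$ (literal $h$ of clause $l$ is $i$), $y^{(s)}_{jr}$ (member $j$ of tuple $s$ is clause $r$), $z_p$ (the assignment), $u_r$, and single variables $[\![y^{(s)}_{jr}\cdot x_{lhi}]\!]$, $[\![x_{lhi}\cdot z_p]\!]$, where $l,r\in[m]$, $h\in\{0,1,2\}$, $i\in[2n]$, $s\in[t]$, $j\in[k]$, $p\in[n]$. Put $$Q^{(s)}_{ijh}=\sum_{r=1}^m[\![y^{(s)}_{jr}\cdot x_{rhi}]\!],\qquad U_r=\sum_{h=0}^{2}\sum_{i=1}^n\Big([\![x_{rhi}\cdot z_i]\!]+x_{rh(i+n)}-[\![x_{rh(i+n)}\cdot z_i]\!]\Big).$$ $\Upsilon$ consists of the following lines, for all values of the free indices: 1. $\sum_{i=1}^{2n}x_{lhi}=1$; 2. $\sum_{r=1}^m y^{(s)}_{jr}=1$; 3. $\sum_{j=1}^k y^{(s)}_{jr}\in\{0,1\}$; 4. $a-[\![a\cdot b]\!]\in\{0,1\}$, $\ b-[\![a\cdot b]\!]\in\{0,1\}$, $\ a+b-[\![a\cdot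 b]\!]\in\{0,1\}$, for every variable $[\![a\cdot b]\!]$ of either kind; 5. $\sum_{j\in[k],h}\big(Q^{(s)}_{ijh}+Q^{(s)}_{(i+n)jh}\big)\in\{e: 0\le e\le c,\ e \text{ even}\}$, for $i\in[n]$; 6. $\sum_{j\in[k],h,\,i\in[n]}Q^{(s)}_{(i+n)jh}\in\{e:0\le e\le c,\ e\text{ odd}\}$; 7. $\sum_{j\in[k],s\in[t]}y^{(s)}_{jr}\in\{0,1,\dots,d\}$; 8. $U_r\in\{0,2\}\lor(u_r=1)$ and $U_r\in\{1,3\}\lor(u_r=0)$; 9. $\sum_{r=1}^m u_r\in\{m-\lceil t/d\rceil+1,\dots,m\}$. It states that some 3CNF with $n$ variables and $m$ clauses has $t$ inconsistent even $k$-tuples of clauses, with every clause in at most $d$ of them, and that some assignment satisfies more than $m-\lceil t/d\rceil$ of its clauses as 3XORs (which is impossible). **Theorem.** There is a polynomial $p$ such that for all $n,m,k,t,d,c$ as above, $\Upsilon_{n,m,k,t,d,c}$ has an R(quad)-refutation of size at most $p(n+m+k+t+d)$. -/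

import Mathlib

noncomputable section

/-! Resolution over disjunctions of quadratic equations with integer coefficients, R(quad). -/

namespace RQuad

/-- The monomials of degree at most two over the variables `V`: the constant monomial, the variables,
and the products `v * w` (with `v * w = w * v`, and with `v * v` distinct from `v`). -/
inductive Mono (V : Type) : Type
  | one : Mono V
  | lin (v : V) : Mono V
  | quad (e : Sym2 V) : Mono V

/-- A quadratic sum `∑ c_ij x_i x_j + ∑ c_i x_i + c` with integer coefficients, in which each
monomial occurs once (the coefficient of a monomial is the value of the function at it). -/
abbrev QuadSum (V : Type) : Type := Mono V →₀ ℤ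

/-- The quadratic sum consisting of the single variable `v`. -/
def var {V : Type} (v : V) : QuadSum V := Finsupp.single (Mono.lin v) 1

/-- The quadratic sum consisting of the single product `v * w`. -/
def prod {V : Type} (v w : V) : QuadSum V := Finsupp.single (Mono.quad s(v, w)) 1

/-- A quadratic equation `lhs = rhs`. -/
@[ext]
structure QuadEq (V : Type) : Type where
  lhs : QuadSum V
  rhs : ℤ

instance (V : Type) : DecidableEq (QuadEq V) := Classical.decEq _

/-- The difference of two equations: `L = a` minus `M = b` is `L - M = a - b`. -/
instance (V : Type) : Sub (QuadEq V) := ⟨fun L M => ⟨L.lhs - M.lhs, L.rhs - M.rhs⟩⟩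

/-- The size of an equation: the sum of the absolute values of all its coefficients, including both
constants (that is, the length of the coefficients in unary notation). -/
def QuadEq.size {V : Type} (L : QuadEq V) : ℕ :=
  L.lhs.sum (fun _ c => c.natAbs) + L.rhs.natAbs

/-- A disjunction of quadratic equations, as the finite set of its disjuncts. The empty disjunction
is the truth value false. -/
abbrev Disj (V : Type) : Type := Finset (QuadEq V)

/-- The size of a disjunction: the total size of its equations. -/
def Disj.size {V : Type} (D : Disj V) : ℕ := ∑ L ∈ D, L.size

/-- The generalized equation `L ∈ S`: the disjunction of the equations `L = a` for `a ∈ S`. -/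
def mem {V : Type} (L : QuadSum V) (S : Finset ℤ) : Disj V := S.image (fun a => ⟨L, a⟩)

/-- `Step K prev D`: the line `D` is in `K`, or is a Boolean axiom, or follows by one application of
an inference rule from lines in the list `prev`. -/
inductive Step {V : Type} (K : Set (Disj V)) (prev : List (Disj V)) : Disj V → Prop
  | hyp (D : Disj V) : D ∈ K → Step K prev D
  | boolVar (v : V) : Step K prev (mem (var v) {0, 1})
  | boolProd (v w : V) : Step K prev (mem (prod v w) {0, 1})
  | boolOr (v w : V) : Step K prev (mem (var v + var w - prod v w) {0, 1})
  | boolDiff (v w : V) : Step K prev (mem (var v - prod v w) {0, 1})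
  | resolution (A B : Disj V) (L M : QuadEq V) :
      insert L A ∈ prev → insert M B ∈ prev → Step K prev (insert (L - M) (A ∪ B))
  | weakening (A : Disj V) (L : QuadEq V) : A ∈ prev → Step K prev (insert L A)
  | simplification (A : Disj V) (a : ℤ) : a ≠ 0 → insert ⟨0, a⟩ A ∈ prev → Step K prev A

/-- `IsProof K π`: the sequence of lines `π` is an R(quad)-proof from the collection `K`, that is,
every line is obtained by `Step` from the lines before it. -/
inductive IsProof {V : Type} (K : Set (Disj V)) : List (Disj V) → Prop
  | nil : IsProof K []
  | snoc (π : List (Disj V)) (D : Disj V) : IsProof K π → Step K π D → IsProof K (π ++ [D])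

/-- An R(quad)-refutation of `K`: an R(quad)-proof from `K` whose last line is the empty
disjunction. -/
def IsRefutation {V : Type} (K : Set (Disj V)) (π : List (Disj V)) : Prop :=
  IsProof K π ∧ π.getLast? = some ∅

/-- The size of a proof: the total size of its lines. -/
def proofSize {V : Type} (π : List (Disj V)) : ℕ := (π.map Disj.size).sum

end RQuad

/-! The formulas expressing the negation of the 3XOR principle. -/

namespace ThreeXor

open RQuad

/-- The literals over `n` variables: `Sum.inl i` is the positive literal `x_i`, and `Sum.inr i` is
the negative literal `¬ x_i`. -/
abbrev Lit (n : ℕ) : Type := Fin n ⊕ Fin n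

/-- The propositional variables. A row of the table `x` is a pair `(l, h)`: the `h`-th literal of the
`l`-th clause.
* `x l h i`: the `h`-th literal of clause `l` of the input 3CNF is `i`;
* `y s j r`: the `j`-th member of the `s`-th tuple is clause `r`;
* `z i`: the assignment to the `i`-th variable;
* `u r`: clause `r` is satisfied as a 3XOR by the assignment;
* `yx s j r l h i`: a single variable standing for the product of `y s j r` and `x l h i`;
* `xz l h i p`: a single variable standing for the product of `x l h i` and `z p`. -/
inductive Var (n m k t : ℕ) : Type
  | x (l : Fin m) (h : Fin 3) (i : Lit n)
  | y (s : Fin t) (j : Fin k) (r : Fin m)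
  | z (i : Fin n)
  | u (r : Fin m)
  | yx (s : Fin t) (j : Fin k) (r : Fin m) (l : Fin m) (h : Fin 3) (i : Lit n)
  | xz (l : Fin m) (h : Fin 3) (i : Lit n) (p : Fin n)

variable {n m k t : ℕ}

/-- The sum expressing that `i` is the `h`-th literal of the `j`-th clause of tuple `s`. -/
def Q (s : Fin t) (j : Fin k) (h : Fin 3) (i : Lit n) : QuadSum (Var n m k t) :=
  ∑ r : Fin m, var (Var.yx s j r r h i)

/-- The number of true literals of clause `j` under the assignment `z`. -/
def U (j : Fin m) : QuadSum (Var n m k t) :=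
  ∑ h : Fin 3,
    (∑ i : Fin n, var (Var.xz j h (Sum.inl i) i) +
     ∑ i : Fin n, (var (Var.x j h (Sum.inr i)) - var (Var.xz j h (Sum.inr i) i)))

/-- The even numbers in `{0, …, c}`. -/
def evens (c : ℕ) : Finset ℤ := (Finset.Icc (0 : ℤ) c).filter Even

/-- The odd numbers in `{0, …, c}`. -/
def odds (c : ℕ) : Finset ℤ := (Finset.Icc (0 : ℤ) c).filter Odd

/-- The lines of the 3XOR principle formula for `n` variables, `m` clauses, and `t` tuples of `k`
clauses each, such that each clause is in at most `d` tuples. The number `c` is the cap on the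
numbers of literal occurrences that the lines `even` and `inconsistent` list. -/
inductive Line (n m k t d c : ℕ) : Disj (Var n m k t) → Prop
  /- Group I -/
  | rowX (l : Fin m) (h : Fin 3) :
      Line n m k t d c (mem (∑ i : Lit n, var (Var.x l h i)) {1})
  | rowY (s : Fin t) (j : Fin k) :
      Line n m k t d c (mem (∑ r : Fin m, var (Var.y s j r)) {1})
  | colY (s : Fin t) (r : Fin m) :
      Line n m k t d c (mem (∑ j : Fin k, var (Var.y s j r)) {0, 1})
  | yx₁ (s : Fin t) (j : Fin k) (r l : Fin m) (h : Fin 3) (i : Lit n) :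
      Line n m k t d c (mem (var (Var.y s j r) - var (Var.yx s j r l h i)) {0, 1})
  | yx₂ (s : Fin t) (j : Fin k) (r l : Fin m) (h : Fin 3) (i : Lit n) :
      Line n m k t d c (mem (var (Var.x l h i) - var (Var.yx s j r l h i)) {0, 1})
  | yx₃ (s : Fin t) (j : Fin k) (r l : Fin m) (h : Fin 3) (i : Lit n) :
      Line n m k t d c
        (mem (var (Var.y s j r) + var (Var.x l h i) - var (Var.yx s j r l h i)) {0, 1})
  | even (s : Fin t) (i : Fin n) :
      Line n m k t d c
        (mem (∑ j : Fin k, ∑ h : Fin 3, (Q s j h (Sum.inl i) + Q s j h (Sum.inr i))) (evens c))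
  | inconsistent (s : Fin t) :
      Line n m k t d c
        (mem (∑ j : Fin k, ∑ h : Fin 3, ∑ i : Fin n, Q s j h (Sum.inr i)) (odds c))
  | atMost (r : Fin m) :
      Line n m k t d c
        (mem (∑ j : Fin k, ∑ s : Fin t, var (Var.y s j r)) (Finset.Icc (0 : ℤ) d))
  /- Group II -/
  | xz₁ (l : Fin m) (h : Fin 3) (i : Lit n) (p : Fin n) :
      Line n m k t d c (mem (var (Var.x l h i) - var (Var.xz l h i p)) {0, 1})
  | xz₂ (l : Fin m) (h : Fin 3) (i : Lit n) (p : Fin n) :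
      Line n m k t d c (mem (var (Var.z p) - var (Var.xz l h i p)) {0, 1})
  | xz₃ (l : Fin m) (h : Fin 3) (i : Lit n) (p : Fin n) :
      Line n m k t d c
        (mem (var (Var.x l h i) + var (Var.z p) - var (Var.xz l h i p)) {0, 1})
  | u₁ (j : Fin m) :
      Line n m k t d c (mem (U j) {0, 2} ∪ {⟨var (Var.u j), 1⟩})
  | u₀ (j : Fin m) :
      Line n m k t d c (mem (U j) {1, 3} ∪ {⟨var (Var.u j), 0⟩})
  | manySat :
      Line n m k t d c
        (mem (∑ j : Fin m, var (Var.u j)) (Finset.Icc ((m : ℤ) - ⌈(t : ℚ) / (d : ℚ)⌉ + 1) m))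

/-- The 3XOR principle formula, as the set of its lines. -/
def Upsilon (n m k t d c : ℕ) : Set (Disj (Var n m k t)) := {D | Line n m k t d c D}

end ThreeXor

end

/-! Fix a tuple and let `P_i`, `N_i` count the positive and negative occurrences of variable `i` in
its clauses. Under the assignment `z`, the number of true literal occurrences in the tuple is `∑ z_i
(P_i - N_i) + ∑ N_i`. Each `P_i + N_i` is even, hence so is `P_i - N_i`, while `∑ N_i` is odd; so
the total is odd. As `u_r` has the parity of the number of true literals of clause `r`, an odd
number of members of the tuple are satisfied as 3XORs (`has_satisfied_odd`), and since `k` is even,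
at least one member is not (`has_one_le`). Over all tuples this gives at least `t` unsatisfied
members. A clause accounts for at most `d (1 - u_r)` of them (`has_le`), so there are at most `d
(⌈t/d⌉ - 1) < t`, a contradiction (`has_false`).

The count involves the cubic terms `y x z`. They stay quadratic because `[y·x]` and `[x·z]` are
single variables: `IsProd.assoc` proves `y [x·z] = z [y·x]`, and this moves the argument from
clauses to variables.

To run the argument inside R(quad), `Has` records that some `L ∈ S` is derivable, with all values in
`S` having a given property (even, odd, at most `b`, ...). Such facts can be added, subtracted,
intersected and proved by cases; the cases rest on carrying side disjunctions through a proof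
(`Der.union_side`, `Der.cases`). Each operation, including a sum over a whole index set, raises the
size bound to a fixed power. The argument has constant depth, so the total size is polynomial. -/

noncomputable section
-- Proof weight, cut, side disjunctions and case analysis.
namespace RQuad

variable {V : Type}

theorem Step.mono {K K' : Set (Disj V)} {π π' : List (Disj V)} {D : Disj V}
    (hK : K ⊆ K') (hπ : ∀ E ∈ π, E ∈ π') (h : Step K π D) : Step K' π' D := by
  cases h with
  | hyp _ h => exact .hyp _ (hK h)
  | boolVar v => exact .boolVar v
  | boolProd v w => exact .boolProd v w
  | boolOr v w => exact .boolOr v w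
  | boolDiff v w => exact .boolDiff v w
  | resolution A B L M h₁ h₂ => exact .resolution A B L M (hπ _ h₁) (hπ _ h₂)
  | weakening A L h => exact .weakening A L (hπ _ h)
  | simplification _ a ha h => exact .simplification _ a ha (hπ _ h)

theorem IsProof.mono {K K' : Set (Disj V)} {π : List (Disj V)} (hK : K ⊆ K')
    (h : IsProof K π) : IsProof K' π := by
  induction h with
  | nil => exact .nil
  | snoc π D _ hD ih => exact .snoc π D ih (hD.mono hK fun _ h => h)

/-- Lines of a second proof which the first proof already contains may serve as its axioms. -/
theorem IsProof.append_filter {K : Set (Disj V)} {π π' : List (Disj V)} {D : Disj V}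
    (h : IsProof K π) (hD : D ∈ π) (h' : IsProof (insert D K) π') :
    IsProof K (π ++ π'.filter (· ≠ D)) := by
  induction h' with
  | nil => simpa using h
  | snoc σ E _ hE ih =>
    by_cases hED : E = D
    · simpa [List.filter_append, hED] using ih
    · have hmem : ∀ F ∈ σ, F ∈ π ++ σ.filter (· ≠ D) := fun F hF => by
        by_cases hFD : F = D
        · simp [hFD, hD]
        · simp [hF, hFD]
      have : Step K (π ++ σ.filter (· ≠ D)) E := by
        cases hE with
        | hyp _ h => exact .hyp _ (h.resolve_left hED)
        | boolVar v => exact .boolVar v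
        | boolProd v w => exact .boolProd v w
        | boolOr v w => exact .boolOr v w
        | boolDiff v w => exact .boolDiff v w
        | resolution A B L M h₁ h₂ => exact .resolution A B L M (hmem _ h₁) (hmem _ h₂)
        | weakening A L h => exact .weakening A L (hmem _ h)
        | simplification _ a ha h => exact .simplification _ a ha (hmem _ h)
      have := IsProof.snoc _ _ ih this
      simpa [List.filter_append, hED] using this

theorem IsProof.append {K : Set (Disj V)} {π π' : List (Disj V)}
    (h : IsProof K π) (h' : IsProof K π') : IsProof K (π ++ π') := by
  induction h' with
  | nil => simpa using h
  | snoc σ E _ hE ih =>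
    rw [← List.append_assoc]
    exact .snoc _ _ ih (hE.mono subset_rfl fun F hF => List.mem_append_right _ hF)

/-- A refutation must end in the empty disjunction, whereas `Der` only asks that it occur;
truncating the proof bridges the gap. -/
theorem IsProof.exists_prefix {K : Set (Disj V)} {π : List (Disj V)} {D : Disj V}
    (h : IsProof K π) (hD : D ∈ π) :
    ∃ π', IsProof K π' ∧ π'.getLast? = some D ∧ proofSize π' ≤ proofSize π := by
  induction h with
  | nil => simp at hD
  | snoc σ E hσ hE ih =>
    rcases List.mem_append.1 hD with h | h
    · obtain ⟨π', h₁, h₂, h₃⟩ := ih h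
      exact ⟨π', h₁, h₂, h₃.trans (by simp [proofSize])⟩
    · obtain rfl : D = E := by simpa using h
      exact ⟨_, .snoc _ _ hσ hE, by simp, le_rfl⟩

/-- The weight of a disjunction: its size, plus one for each disjunct, plus one. -/
def wt (D : Disj V) : ℕ := 1 + ∑ L ∈ D, (1 + L.size)

/-- The total weight of the lines of a proof. -/
def cost (π : List (Disj V)) : ℕ := (π.map wt).sum

theorem size_le_wt (D : Disj V) : D.size ≤ wt D := by
  unfold Disj.size wt
  rw [Finset.sum_add_distrib]
  omega

theorem card_lt_wt (D : Disj V) : D.card < wt D := by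
  unfold wt
  rw [Finset.sum_add_distrib]
  simp only [Finset.sum_const, smul_eq_mul, mul_one]
  omega

theorem one_le_wt (D : Disj V) : 1 ≤ wt D := by unfold wt; omega

theorem wt_mono {D E : Disj V} (h : D ⊆ E) : wt D ≤ wt E :=
  Nat.add_le_add_left (Finset.sum_le_sum_of_subset h) 1

theorem wt_union_lt (D E : Disj V) : wt (D ∪ E) < wt D + wt E := by
  unfold wt
  have := Finset.sum_union_inter (s₁ := D) (s₂ := E) (f := fun L : QuadEq V => 1 + L.size)
  omega

theorem wt_union_le_mul (D E : Disj V) : wt (D ∪ E) ≤ wt D * wt E := by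
  have h := wt_union_lt D E
  have h₁ := one_le_wt D
  have h₂ := one_le_wt E
  nlinarith

theorem proofSize_le_cost (π : List (Disj V)) : proofSize π ≤ cost π :=
  List.sum_le_sum fun D _ => size_le_wt D

@[simp] theorem cost_append (π π' : List (Disj V)) : cost (π ++ π') = cost π + cost π' := by
  simp [cost]

@[simp] theorem cost_singleton (D : Disj V) : cost [D] = wt D := by simp [cost]

/-- `Der K N D`: there is a proof of `D` from `K` of total weight at most `N`. -/
def Der (K : Set (Disj V)) (N : ℕ) (D : Disj V) : Prop :=
  ∃ π, IsProof K π ∧ D ∈ π ∧ cost π ≤ N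

variable {K K' : Set (Disj V)} {N N' : ℕ} {A B D E : Disj V} {L M : QuadEq V}

theorem Der.mono (h : Der K N D) (hK : K ⊆ K') (hN : N ≤ N') : Der K' N' D := by
  obtain ⟨π, h₁, h₂, h₃⟩ := h
  exact ⟨π, h₁.mono hK, h₂, h₃.trans hN⟩

theorem Der.of_step (h : Step K [] D) : Der K (wt D) D :=
  ⟨[D], .snoc [] D .nil h, by simp, by simp⟩

theorem Der.hyp (h : D ∈ K) : Der K (wt D) D := .of_step (.hyp _ h)

theorem Der.resolve (h₁ : Der K N (insert L A)) (h₂ : Der K N' (insert M B)) :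
    Der K (N + N' + wt (insert (L - M) (A ∪ B))) (insert (L - M) (A ∪ B)) := by
  obtain ⟨π, hπ, hD, hc⟩ := h₁
  obtain ⟨π', hπ', hD', hc'⟩ := h₂
  refine ⟨π ++ π' ++ [_], .snoc _ _ (hπ.append hπ') (.resolution A B L M ?_ ?_), ?_, ?_⟩
  · simp [hD]
  · simp [hD']
  · simp
  · simp only [cost_append, cost_singleton]; omega

theorem Der.weaken_insert (h : Der K N A) : Der K (N + wt (insert L A)) (insert L A) := by
  obtain ⟨π, hπ, hD, hc⟩ := h
  refine ⟨π ++ [_], .snoc _ _ hπ (.weakening A L hD), by simp, ?_⟩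
  simp only [cost_append, cost_singleton]; omega

theorem Der.simplify {a : ℤ} (ha : a ≠ 0) (h : Der K N (insert ⟨0, a⟩ A)) :
    Der K (N + wt A) A := by
  obtain ⟨π, hπ, hD, hc⟩ := h
  refine ⟨π ++ [_], .snoc _ _ hπ (.simplification A a ha hD), by simp, ?_⟩
  simp only [cost_append, cost_singleton]; omega

/-- The costs add, however often the second proof uses `D`: lines may be reused, so one derivation
of `D` suffices. -/
theorem Der.cut (h : Der K N D) (h' : Der (insert D K) N' E) : Der K (N + N') E := by
  obtain ⟨π, hπ, hD, hc⟩ := h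
  obtain ⟨π', hπ', hE, hc'⟩ := h'
  refine ⟨_, hπ.append_filter hD hπ', ?_, ?_⟩
  · by_cases hED : E = D
    · simp [hED, hD]
    · simp [hE, hED]
  · have : cost (π'.filter (· ≠ D)) ≤ cost π' :=
      ((List.filter_sublist (l := π')).map wt).sum_le_sum fun _ _ => Nat.zero_le _
    rw [cost_append]
    omega

theorem Der.weaken_union (h : Der K N D) (A : Disj V) :
    Der K (N + A.card * wt (D ∪ A)) (D ∪ A) := by
  induction A using Finset.induction_on with
  | empty => simpa using h
  | insert L A hL ih =>
    rw [Finset.union_insert]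
    refine (ih.weaken_insert (L := L)).mono subset_rfl ?_
    rw [Finset.card_insert_of_notMem hL]
    have := wt_mono (Finset.subset_insert L (D ∪ A))
    nlinarith

theorem Der.weaken (h : Der K N D) (hDE : D ⊆ E) : Der K (N + wt E ^ 2) E := by
  have := h.weaken_union E
  rw [Finset.union_eq_right.2 hDE] at this
  refine this.mono subset_rfl ?_
  have := card_lt_wt E
  nlinarith

/-- A side disjunction may be carried through a proof, in the style of a deduction theorem. -/
theorem Der.union_side {X : Disj V} (h : Der (insert X K) N D) (A : Disj V) :
    Der (insert (X ∪ A) K) (N * wt A ^ 2) (D ∪ A) := by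
  obtain ⟨π, hπ, hD, hc⟩ := h
  suffices h : ∃ π', IsProof (insert (X ∪ A) K) π' ∧ (∀ F ∈ π, F ∪ A ∈ π') ∧
      cost π' ≤ cost π * wt A ^ 2 by
    obtain ⟨π', h₁, h₂, h₃⟩ := h
    exact ⟨π', h₁, h₂ _ hD, h₃.trans (Nat.mul_le_mul_right _ hc)⟩
  clear hD hc
  induction hπ with
  | nil => exact ⟨[], .nil, by simp, by simp [cost]⟩
  | snoc σ F _ hF ih =>
    obtain ⟨π', h₁, h₂, h₃⟩ := ih
    have hA := one_le_wt A
    have hF1 := one_le_wt F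
    have hFA := wt_union_le_mul F A
    suffices h : ∃ σ', IsProof (insert (X ∪ A) K) (π' ++ σ') ∧ F ∪ A ∈ π' ++ σ' ∧
        cost σ' ≤ wt F * wt A ^ 2 by
      obtain ⟨σ', g₁, g₂, g₃⟩ := h
      refine ⟨_, g₁, fun G hG => ?_, ?_⟩
      · rcases List.mem_append.1 hG with hG | hG
        · exact List.mem_append_left _ (h₂ G hG)
        · obtain rfl : G = F := by simpa using hG
          exact g₂
      · simp only [cost_append, cost_singleton, add_mul]
        omega
    have single : Step (insert (X ∪ A) K) π' (F ∪ A) → ∃ σ', IsProof (insert (X ∪ A) K) (π' ++ σ') ∧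
        F ∪ A ∈ π' ++ σ' ∧ cost σ' ≤ wt F * wt A ^ 2 := fun hs =>
      ⟨[F ∪ A], .snoc _ _ h₁ hs, by simp, by
        rw [cost_singleton]
        exact hFA.trans (Nat.mul_le_mul_left _ (by nlinarith))⟩
    -- Axioms do not come with `A` attached; it is added one disjunct at a time, in `A.card` lines
    -- of weight at most `wt F * wt A`. This is where the square of `wt A` comes from.
    have axm : Step (insert (X ∪ A) K) [] F → ∃ σ', IsProof (insert (X ∪ A) K) (π' ++ σ') ∧
        F ∪ A ∈ π' ++ σ' ∧ cost σ' ≤ wt F * wt A ^ 2 := fun hs => by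
      obtain ⟨τ, t₁, t₂, t₃⟩ := (Der.of_step hs).weaken_union A
      refine ⟨τ, h₁.append t₁, by simp [t₂], t₃.trans ?_⟩
      have := card_lt_wt A
      calc wt F + A.card * wt (F ∪ A) ≤ wt F + A.card * (wt F * wt A) := by gcongr
        _ ≤ wt F * wt A + A.card * (wt F * wt A) := by nlinarith
        _ = (A.card + 1) * (wt F * wt A) := by ring
        _ ≤ wt A * (wt F * wt A) := Nat.mul_le_mul_right _ this
        _ = _ := by ring
    cases hF with
    | hyp _ h =>
      rcases h with rfl | h
      · exact single (.hyp _ (Set.mem_insert _ _))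
      · exact axm (.hyp _ (Set.mem_insert_of_mem _ h))
    | boolVar v => exact axm (.boolVar v)
    | boolProd v w => exact axm (.boolProd v w)
    | boolOr v w => exact axm (.boolOr v w)
    | boolDiff v w => exact axm (.boolDiff v w)
    | resolution B C L M g₁ g₂ =>
      refine single ?_
      have := Step.resolution (K := insert (X ∪ A) K) (prev := π') (B ∪ A) (C ∪ A) L M
        (by simpa [Finset.insert_union] using h₂ _ g₁)
        (by simpa [Finset.insert_union] using h₂ _ g₂)
      rwa [← Finset.union_union_distrib_right, ← Finset.insert_union] at this
    | weakening B L g =>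
      refine single ?_
      rw [Finset.insert_union]
      exact .weakening _ _ (h₂ _ g)
    | simplification _ a ha g =>
      refine single (.simplification _ a ha ?_)
      rw [← Finset.insert_union]
      exact h₂ _ g

theorem mem_insert (L : QuadSum V) (a : ℤ) (S : Finset ℤ) :
    mem L (insert a S) = insert ⟨L, a⟩ (mem L S) := Finset.image_insert _ _ _

theorem mem_singleton (L : QuadSum V) (a : ℤ) : mem L {a} = {⟨L, a⟩} := Finset.image_singleton _ _

theorem mem_mono (L : QuadSum V) {S T : Finset ℤ} (h : S ⊆ T) : mem L S ⊆ mem L T :=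
  Finset.image_subset_image h

theorem card_mem (L : QuadSum V) (S : Finset ℤ) : (mem L S).card = S.card :=
  Finset.card_image_of_injective _ fun _ _ h => congrArg QuadEq.rhs h

/-- Case analysis over the disjuncts of a generalized equation. -/
theorem Der.cases {L : QuadSum V} {S : Finset ℤ} {W e : ℕ} (hW : 8 ≤ W) (hS : wt (mem L S) ≤ W)
    (hD : wt D ≤ W) (h : ∀ a ∈ S, Der (insert {⟨L, a⟩} K) (W ^ e) D) :
    Der (insert (mem L S) K) (W ^ (e + 5)) D := by
  -- The disjuncts `L = a` are eliminated one by one, each subproof carrying the remaining ones and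
  -- `D` as side disjunction. That side has weight at most `2 * W` at every stage, so the costs of
  -- the cases add up instead of compounding.
  have key : ∀ T ⊆ S, Der (insert (mem L T ∪ D) K) (T.card * (W ^ e * (2 * W) ^ 2) + W) D := by
    intro T
    induction T using Finset.induction_on with
    | empty =>
      intro _
      refine (Der.hyp ?_).mono subset_rfl (hD.trans (by simp))
      simp [mem]
    | insert a T ha ih =>
      intro hT
      rw [mem_insert, Finset.insert_union, Finset.insert_eq]
      have hTS : T ⊆ S := (Finset.subset_insert a T).trans hT
      have h₁ := (h a (hT (Finset.mem_insert_self a T))).union_side (mem L T ∪ D)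
      have h₂ : D ∪ (mem L T ∪ D) = mem L T ∪ D :=
        Finset.union_eq_right.2 Finset.subset_union_right
      rw [h₂] at h₁
      refine (h₁.cut ((ih hTS).mono ?_ le_rfl)).mono subset_rfl ?_
      · exact Set.insert_subset_insert (Set.subset_insert _ _)
      · rw [Finset.card_insert_of_notMem ha]
        have hw : wt (mem L T ∪ D) ≤ 2 * W := by
          have := wt_union_lt (mem L T) D
          have := wt_mono (mem_mono L hTS)
          omega
        have : W ^ e * wt (mem L T ∪ D) ^ 2 ≤ W ^ e * (2 * W) ^ 2 := by gcongr
        rw [add_mul, one_mul]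
        omega
  have h₀ : Der (insert (mem L S) K) (W + (2 * W) ^ 2) (mem L S ∪ D) := by
    refine ((Der.hyp (Set.mem_insert _ _)).weaken (Finset.subset_union_left)).mono subset_rfl ?_
    have := wt_union_lt (mem L S) D
    gcongr
    omega
  refine (h₀.cut ((key S subset_rfl).mono ?_ le_rfl)).mono subset_rfl ?_
  · exact Set.insert_subset_insert (Set.subset_insert _ _)
  · have hc : S.card ≤ W := by
      have := card_lt_wt (mem L S)
      rw [card_mem] at this
      omega
    have h1 : 1 ≤ W ^ e := Nat.one_le_pow _ _ (by omega)
    have h2 : S.card * (W ^ e * (2 * W) ^ 2) ≤ W * (W ^ e * (2 * W) ^ 2) := by gcongr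
    have h3 : W + (2 * W) ^ 2 + (W * (W ^ e * (2 * W) ^ 2) + W) ≤ W ^ e * W ^ 4 := by
      have e1 : W ^ e * W ^ 4 = W ^ e * (W ^ 3 * W) := by ring
      have e2 : W * (W ^ e * (2 * W) ^ 2) = W ^ e * (W ^ 3 * 4) := by ring
      have e3 : W + (2 * W) ^ 2 + W ≤ W ^ 3 * 4 := by nlinarith [sq_nonneg W, mul_le_mul hW hW]
      have e4 : W ^ e * (W ^ 3 * 8) ≤ W ^ e * (W ^ 3 * W) := by gcongr
      nlinarith
    calc _ ≤ W ^ e * W ^ 4 := by omega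
      _ = W ^ (e + 4) := by ring
      _ ≤ _ := Nat.pow_le_pow_right (by omega) (by omega)

end RQuad

/-! ### Norms, and arithmetic of derivable generalized equations. -/

namespace RQuad

variable {V : Type}

/-- The sum of the absolute values of the coefficients of a quadratic sum. -/
def nrm (L : QuadSum V) : ℕ := L.sum fun _ c => c.natAbs

theorem nrm_eq_sum {L : QuadSum V} {s : Finset (Mono V)} (h : L.support ⊆ s) :
    nrm L = ∑ i ∈ s, (L i).natAbs :=
  Finsupp.sum_of_support_subset _ h _ fun _ _ => rfl

@[simp] theorem nrm_zero : nrm (0 : QuadSum V) = 0 := rfl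

theorem nrm_sub_le (L M : QuadSum V) : nrm (L - M) ≤ nrm L + nrm M := by
  classical
  rw [nrm_eq_sum (Finset.subset_union_left (s₁ := L.support) (s₂ := M.support)),
    nrm_eq_sum (Finset.subset_union_right (s₁ := L.support) (s₂ := M.support)),
    nrm_eq_sum (Finsupp.support_sub (f := L) (g := M)), ← Finset.sum_add_distrib]
  exact Finset.sum_le_sum fun i _ => by rw [Finsupp.sub_apply]; omega

theorem nrm_neg (L : QuadSum V) : nrm (-L) = nrm L := by
  rw [nrm_eq_sum (L := -L) (s := L.support) (by simp), nrm_eq_sum subset_rfl]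
  simp

theorem nrm_add_le (L M : QuadSum V) : nrm (L + M) ≤ nrm L + nrm M := by
  have := nrm_sub_le L (-M)
  rwa [sub_neg_eq_add, nrm_neg] at this

theorem nrm_sum_le {ι : Type*} (I : Finset ι) (L : ι → QuadSum V) {b : ℕ}
    (h : ∀ i ∈ I, nrm (L i) ≤ b) : nrm (∑ i ∈ I, L i) ≤ I.card * b := by
  induction I using Finset.cons_induction with
  | empty => simp
  | cons i I hi ih =>
    rw [Finset.sum_cons, Finset.card_cons, add_mul, one_mul]
    have := ih fun j hj => h j (Finset.mem_cons_of_mem hj)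
    have := h i (Finset.mem_cons_self _ _)
    have := nrm_add_le (L i) (∑ i ∈ I, L i)
    omega

theorem nrm_univ_sum_le {ι : Type*} [Fintype ι] (L : ι → QuadSum V) {b : ℕ}
    (h : ∀ i, nrm (L i) ≤ b) : nrm (∑ i, L i) ≤ Fintype.card ι * b :=
  nrm_sum_le _ _ fun i _ => h i

@[simp] theorem nrm_var (v : V) : nrm (var v) = 1 := by simp [nrm, var]

@[simp] theorem nrm_prod (v w : V) : nrm (prod v w) = 1 := by simp [nrm, prod]

theorem wt_eq_singleton (L : QuadSum V) (a : ℤ) :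
    wt {(⟨L, a⟩ : QuadEq V)} = 2 + nrm L + a.natAbs := by
  simp only [wt, Finset.sum_singleton, QuadEq.size, nrm]
  omega

theorem natAbs_le_of_abs_le {a : ℤ} {R : ℕ} (h : |a| ≤ (R : ℤ)) : a.natAbs ≤ R := by
  rw [Int.abs_eq_natAbs] at h
  exact_mod_cast h

theorem wt_mem_le {L : QuadSum V} {S : Finset ℤ} {R : ℕ} (hL : nrm L ≤ R)
    (hS : ∀ a ∈ S, |a| ≤ (R : ℤ)) : wt (mem L S) ≤ 8 * (R + 1) ^ 2 := by
  have hc : S.card ≤ 2 * R + 1 := by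
    have : S ⊆ Finset.Icc (-(R : ℤ)) R := fun a ha => Finset.mem_Icc.2 (abs_le.1 (hS a ha))
    refine (Finset.card_le_card this).trans ?_
    rw [Int.card_Icc]
    omega
  have : ∑ M ∈ mem L S, (1 + M.size) ≤ (mem L S).card • (1 + 2 * R) := by
    refine Finset.sum_le_card_nsmul _ _ _ fun M hM => ?_
    obtain ⟨a, ha, rfl⟩ := Finset.mem_image.1 hM
    have h₁ := natAbs_le_of_abs_le (hS a ha)
    have h₂ : QuadEq.size ⟨L, a⟩ = nrm L + a.natAbs := rfl
    omega
  rw [card_mem, smul_eq_mul] at this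
  unfold wt
  nlinarith [Nat.mul_le_mul_right (1 + 2 * R) hc]

variable {K K' : Set (Disj V)} {N N' : ℕ} {D : Disj V}

theorem Der.sub_eq {L M : QuadSum V} {a b : ℤ} (h₁ : Der K N {⟨L, a⟩}) (h₂ : Der K N' {⟨M, b⟩}) :
    Der K (N + N' + (2 + nrm (L - M) + (a - b).natAbs)) {⟨L - M, a - b⟩} := by
  have := Der.resolve (A := ∅) (B := ∅) (L := ⟨L, a⟩) (M := ⟨M, b⟩) h₁ h₂
  have e : (insert ((⟨L, a⟩ : QuadEq V) - ⟨M, b⟩) (∅ ∪ ∅) : Disj V) = {⟨L - M, a - b⟩} := rfl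
  rw [e, wt_eq_singleton] at this
  exact this

/-- The calculus only subtracts, so addition is `L - ((M - M) - M)`; hence the factor `3`. -/
theorem Der.add_eq {L M : QuadSum V} {a b : ℤ} (h₁ : Der K N {⟨L, a⟩}) (h₂ : Der K N' {⟨M, b⟩}) :
    Der K (N + 3 * N' + 6 + nrm M + b.natAbs + nrm (L + M) + (a + b).natAbs) {⟨L + M, a + b⟩} := by
  have := h₁.sub_eq ((h₂.sub_eq h₂).sub_eq h₂)
  simp only [sub_self, zero_sub, sub_neg_eq_add, nrm_neg, nrm_zero, Int.natAbs_neg,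
    Int.natAbs_zero] at this
  exact this.mono subset_rfl (by omega)

theorem Der.cases₂ {L M : QuadSum V} {S T : Finset ℤ} {W : ℕ} (hW : 8 ≤ W)
    (hL : Der K N (mem L S)) (hM : Der K N' (mem M T))
    (hS : wt (mem L S) ≤ W) (hT : wt (mem M T) ≤ W) (hD : wt D ≤ W)
    (h : ∀ a ∈ S, ∀ b ∈ T, Der (insert {⟨M, b⟩} (insert {⟨L, a⟩} K)) (W ^ 3) D) :
    Der K (N + N' + W ^ 13) D := by
  have h₁ : Der (insert (mem L S) (insert (mem M T) K)) (W ^ 13) D := by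
    refine Der.cases hW hS hD fun a ha => ?_
    rw [Set.insert_comm]
    exact Der.cases hW hT hD fun b hb => h a ha b hb
  exact (hM.cut ((hL.mono (Set.subset_insert _ _) le_rfl).cut h₁)).mono subset_rfl (by omega)

/-- Some generalized equation `L ∈ S` has a proof of weight at most `N`, where the norm of `L` and
the elements of `S` are bounded by `R`, and the elements of `S` satisfy `p`. -/
def HasN (K : Set (Disj V)) (N R : ℕ) (L : QuadSum V) (p : ℤ → Prop) : Prop :=
  nrm L ≤ R ∧ ∃ S : Finset ℤ, (∀ a ∈ S, |a| ≤ (R : ℤ) ∧ p a) ∧ Der K N (mem L S)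

variable {R R' W : ℕ} {L M : QuadSum V} {p q r : ℤ → Prop}

theorem HasN.mono (h : HasN K N R L p) (hK : K ⊆ K') (hN : N ≤ N') (hR : R ≤ R')
    (hp : ∀ a, p a → q a) : HasN K' N' R' L q := by
  obtain ⟨h₁, S, h₂, h₃⟩ := h
  exact ⟨h₁.trans hR, S, fun a ha => ⟨(h₂ a ha).1.trans (by exact_mod_cast hR), hp a (h₂ a ha).2⟩,
    h₃.mono hK hN⟩

theorem eight_le_of_sq {X : ℕ} (h : 8 * (X + 1) ^ 2 ≤ W) : 8 ≤ W :=
  le_trans (by nlinarith [Nat.one_le_pow 2 (X + 1) (by omega)]) h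

/-- Combination of two generalized equations by an operation available for single equations. -/
theorem HasN.map₂ (hL : HasN K N R L p) (hM : HasN K N' R' M q) (hW : 8 * (R + R' + 1) ^ 2 ≤ W)
    (P : QuadSum V) (f : ℤ → ℤ → ℤ) (hP : nrm P ≤ nrm L + nrm M)
    (hf : ∀ a b, |f a b| ≤ |a| + |b|)
    (hd : ∀ (K : Set (Disj V)) a b N N', Der K N {⟨L, a⟩} → Der K N' {⟨M, b⟩} →
      Der K (N + 3 * N' + 6 + nrm M + b.natAbs + nrm P + (f a b).natAbs) {⟨P, f a b⟩})
    (hr : ∀ a b, p a → q b → r (f a b)) :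
    HasN K (N + N' + W ^ 13) (R + R') P r := by
  obtain ⟨h₁, S, hS, dS⟩ := hL
  obtain ⟨h₂, T, hT, dT⟩ := hM
  have hPR : nrm P ≤ R + R' := by omega
  have hU : ∀ c ∈ Finset.image₂ f S T, |c| ≤ ((R + R' : ℕ) : ℤ) ∧ r c := by
    intro c hc
    obtain ⟨a, ha, b, hb, rfl⟩ := Finset.mem_image₂.1 hc
    refine ⟨(hf a b).trans ?_, hr a b (hS a ha).2 (hT b hb).2⟩
    have := (hS a ha).1
    have := (hT b hb).1
    push_cast
    omega
  refine ⟨hPR, _, hU, ?_⟩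
  have hwS : wt (mem L S) ≤ W := (wt_mem_le h₁ fun a ha => (hS a ha).1).trans
    (le_trans (by gcongr; omega) hW)
  have hwT : wt (mem M T) ≤ W := (wt_mem_le h₂ fun a ha => (hT a ha).1).trans
    (le_trans (by gcongr; omega) hW)
  have hwU := (wt_mem_le hPR fun a ha => (hU a ha).1).trans hW
  have hW8 := eight_le_of_sq hW
  refine Der.cases₂ hW8 dS dT hwS hwT hwU fun a ha b hb => ?_
  have := hd (insert {⟨M, b⟩} (insert {⟨L, a⟩} K)) a b _ _ (Der.hyp (by simp)) (Der.hyp (by simp))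
  refine (this.weaken (E := mem P (Finset.image₂ f S T)) ?_).mono subset_rfl ?_
  · rw [Finset.singleton_subset_iff]
    exact Finset.mem_image_of_mem _ (Finset.mem_image₂_of_mem ha hb)
  · rw [wt_eq_singleton, wt_eq_singleton]
    have i₄ := natAbs_le_of_abs_le (hU _ (Finset.mem_image₂_of_mem ha hb)).1
    have i₅ := natAbs_le_of_abs_le (hS a ha).1
    have i₆ := natAbs_le_of_abs_le (hT b hb).1
    have i₇ : wt (mem P (Finset.image₂ f S T)) ^ 2 ≤ W ^ 2 := by gcongr
    have i₈ : 8 * (R + R' + 1) ≤ W := le_trans (by nlinarith) hW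
    have i₉ : W * W + W ^ 2 ≤ W ^ 3 := by nlinarith [sq_nonneg W]
    nlinarith

theorem HasN.sub (hL : HasN K N R L p) (hM : HasN K N' R' M q) (hW : 8 * (R + R' + 1) ^ 2 ≤ W)
    (hr : ∀ a b, p a → q b → r (a - b)) : HasN K (N + N' + W ^ 13) (R + R') (L - M) r :=
  hL.map₂ hM hW (L - M) (· - ·) (nrm_sub_le _ _) (fun a b => abs_sub a b)
    (fun _ _ _ _ _ h₁ h₂ => (h₁.sub_eq h₂).mono subset_rfl (by omega)) hr

theorem HasN.add (hL : HasN K N R L p) (hM : HasN K N' R' M q) (hW : 8 * (R + R' + 1) ^ 2 ≤ W)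
    (hr : ∀ a b, p a → q b → r (a + b)) : HasN K (N + N' + W ^ 13) (R + R') (L + M) r :=
  hL.map₂ hM hW (L + M) (· + ·) (nrm_add_le _ _) (fun a b => abs_add_le a b)
    (fun _ _ _ _ _ h₁ h₂ => h₁.add_eq h₂) hr

/-- Two distinct values `a`, `b` of `L` yield `0 = a - b`, which simplification refutes, so only
common values survive. With incompatible properties this is how contradictions arise. -/
theorem HasN.inter (hL : HasN K N R L p) (hM : HasN K N' R L q) (hW : 8 * (R + R + 1) ^ 2 ≤ W) :
    HasN K (N + N' + W ^ 13) R L fun a => p a ∧ q a := by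
  obtain ⟨h₁, S, hS, dS⟩ := hL
  obtain ⟨-, T, hT, dT⟩ := hM
  have hU : ∀ c ∈ S ∩ T, |c| ≤ (R : ℤ) ∧ p c ∧ q c := fun c hc => by
    obtain ⟨hcS, hcT⟩ := Finset.mem_inter.1 hc
    exact ⟨(hS c hcS).1, (hS c hcS).2, (hT c hcT).2⟩
  refine ⟨h₁, _, hU, ?_⟩
  have hRW : 8 * (R + 1) ^ 2 ≤ W := le_trans (by gcongr; omega) hW
  have hwS := (wt_mem_le h₁ fun a ha => (hS a ha).1).trans hRW
  have hwT := (wt_mem_le h₁ fun a ha => (hT a ha).1).trans hRW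
  have hwU := (wt_mem_le h₁ fun a ha => (hU a ha).1).trans hRW
  have hW8 := eight_le_of_sq hW
  refine Der.cases₂ hW8 dS dT hwS hwT hwU fun a ha b hb => ?_
  have d₁ : Der (insert {⟨L, b⟩} (insert {⟨L, a⟩} K)) _ {⟨L, a⟩} := Der.hyp (by simp)
  have d₂ : Der (insert {⟨L, b⟩} (insert {⟨L, a⟩} K)) _ {⟨L, b⟩} := Der.hyp (by simp)
  rw [wt_eq_singleton] at d₁ d₂
  have i₃ := natAbs_le_of_abs_le (hS a ha).1
  have i₄ := natAbs_le_of_abs_le (hT b hb).1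
  have i₅ : (a - b).natAbs ≤ R + R := by omega
  have i₇ : wt (mem L (S ∩ T)) ^ 2 ≤ W ^ 2 := by gcongr
  have i₈ : 8 * (R + R + 1) ≤ W := le_trans (by nlinarith) hW
  have i₉ : W * W + W ^ 2 ≤ W ^ 3 := by nlinarith [sq_nonneg W]
  by_cases hab : a = b
  · refine (d₁.weaken (E := mem L (S ∩ T)) ?_).mono subset_rfl ?_
    · rw [Finset.singleton_subset_iff]
      exact Finset.mem_image_of_mem _ (Finset.mem_inter.2 ⟨ha, hab ▸ hb⟩)
    · nlinarith
  · have d₃ := d₁.sub_eq d₂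
    rw [sub_self, nrm_zero] at d₃
    have d₄ := Der.simplify (A := ∅) (sub_ne_zero.2 hab) d₃
    refine (d₄.weaken (Finset.empty_subset (mem L (S ∩ T)))).mono subset_rfl ?_
    have : wt (∅ : Disj V) = 1 := rfl
    rw [this]
    nlinarith

theorem HasN.cases (hL : HasN K N R L p) (hW : 8 * (R + 1) ^ 2 ≤ W) (hN : N' ≤ W) (hM : nrm M ≤ R)
    (h : ∀ a, |a| ≤ (R : ℤ) → p a → HasN (insert {⟨L, a⟩} K) N' R M q) :
    HasN K (N + W ^ 8) R M q := by
  obtain ⟨h₁, S, hS, dS⟩ := hL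
  have h' : ∀ a, ∃ T : Finset ℤ, a ∈ S → (∀ b ∈ T, |b| ≤ (R : ℤ) ∧ q b) ∧
      Der (insert {⟨L, a⟩} K) N' (mem M T) := fun a => by
    by_cases ha : a ∈ S
    · obtain ⟨-, T, hT⟩ := h a (hS a ha).1 (hS a ha).2
      exact ⟨T, fun _ => hT⟩
    · exact ⟨∅, fun h => absurd h ha⟩
  choose T hT using h'
  -- The cases may produce different value sets; their union serves all of them.
  have hU : ∀ b ∈ S.biUnion T, |b| ≤ (R : ℤ) ∧ q b := fun b hb => by
    obtain ⟨a, ha, hab⟩ := Finset.mem_biUnion.1 hb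
    exact (hT a ha).1 b hab
  refine ⟨hM, _, hU, ?_⟩
  have hwS := (wt_mem_le h₁ fun a ha => (hS a ha).1).trans hW
  have hwU := (wt_mem_le hM fun a ha => (hU a ha).1).trans hW
  have hW8 := eight_le_of_sq hW
  refine dS.cut (Der.cases hW8 hwS hwU fun a ha => ?_)
  refine ((hT a ha).2.weaken (mem_mono M (Finset.subset_biUnion_of_mem T ha))).mono subset_rfl ?_
  have i₇ : wt (mem M (S.biUnion T)) ^ 2 ≤ W ^ 2 := by gcongr
  nlinarith [sq_nonneg W]

/-- The starting point for sums. It is not an axiom: in either case of `v ∈ {0, 1}` the equation is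
subtracted from itself, so some variable must exist. -/
theorem Der.zero_eq [Nonempty V] : Der K (8 ^ 8) {⟨0, 0⟩} := by
  obtain ⟨v⟩ := ‹Nonempty V›
  have h₀ : wt (mem (var v) {0, 1}) ≤ 8 := by
    rw [wt, mem_insert, mem_singleton, Finset.sum_pair (by simp [QuadEq.ext_iff])]
    have : ∀ a, QuadEq.size ⟨var v, a⟩ = nrm (var v) + a.natAbs := fun _ => rfl
    simp [this]
  have h₁ : wt ({⟨0, 0⟩} : Disj V) = 2 := wt_eq_singleton 0 0
  have h₂ : Der (insert (mem (var v) {0, 1}) K) (8 ^ 7) {⟨0, 0⟩} := by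
    refine Der.cases le_rfl h₀ (by omega) (e := 2) fun a ha => ?_
    have d : Der (insert {⟨var v, a⟩} K) _ {⟨var v, a⟩} := Der.hyp (by simp)
    have := d.sub_eq d
    rw [sub_self, sub_self, nrm_zero, wt_eq_singleton, nrm_var] at this
    refine this.mono subset_rfl ?_
    have : a = 0 ∨ a = 1 := by simpa using ha
    rcases this with rfl | rfl <;> simp
  exact ((Der.of_step (.boolVar v)).cut h₂).mono subset_rfl (by omega)

/-- `W` is chosen for the norm of the entire sum, so every addition costs the same and the cost is
linear in the number of summands. Iterating `Has.add` would instead use one level per summand. The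
index of `p` counts the summands so far, which allows bounds like `a ≤ c * b`. -/
theorem HasN.sum [Nonempty V] {ι : Type*} (I : Finset ι) (L : ι → QuadSum V) (p : ℕ → ℤ → Prop)
    (hW : 8 * (I.card * R + 1) ^ 2 ≤ W) (h₀ : p 0 0)
    (hs : ∀ c a b, p c a → q b → p (c + 1) (a + b)) (h : ∀ i ∈ I, HasN K N R (L i) q) :
    HasN K (8 ^ 8 + I.card * (N + W ^ 13)) (I.card * R) (∑ i ∈ I, L i) (p I.card) := by
  induction I using Finset.cons_induction with
  | empty =>
    refine ⟨by simp, {0}, by simpa using h₀, ?_⟩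
    exact (Der.zero_eq (V := V)).mono subset_rfl le_self_add
  | cons i I hi ih =>
    rw [Finset.card_cons] at hW
    have h₁ := ih (le_trans (by gcongr; omega) hW) fun j hj => h j (Finset.mem_cons_of_mem hj)
    have h₂ := h i (Finset.mem_cons_self i I)
    rw [Finset.sum_cons, Finset.card_cons, add_comm (L i)]
    refine (h₁.add h₂ (W := W) (by rwa [← Nat.succ_mul]) (hs _)).mono subset_rfl ?_ ?_
      fun _ h => h <;>
      · rw [add_mul]; omega

/-! ### Size levels: each operation raises the bound to a fixed power. -/

/-- The size bound at level `l`: a fixed power of `s`, depending on `l`. -/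
def bd (s l : ℕ) : ℕ := s ^ 100 ^ l

theorem bd_succ (s l : ℕ) : bd s (l + 1) = bd s l ^ 100 := by
  rw [bd, bd, pow_succ, pow_mul]

theorem le_bd (s l : ℕ) [Fact (16 ≤ s)] : s ≤ bd s l :=
  Nat.le_self_pow (by positivity) s

theorem bd_mono {s l l' : ℕ} [hs : Fact (16 ≤ s)] (h : l ≤ l') : bd s l ≤ bd s l' :=
  Nat.pow_le_pow_right (by have := hs.out; omega) (Nat.pow_le_pow_right (by omega) h)

theorem pow_le_bd {s e l : ℕ} [hs : Fact (16 ≤ s)] (h : e ≤ 100 ^ l) : s ^ e ≤ bd s l :=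
  Nat.pow_le_pow_right (by have := hs.out; omega) h

theorem sixteen_le_bd (s l : ℕ) [hs : Fact (16 ≤ s)] : 16 ≤ bd s l := hs.out.trans (le_bd s l)

/-- `Has s K l L p`: a generalized equation `L ∈ S`, with the elements of `S` satisfying `p`, can be
derived from `K` within the size bound at level `l`. -/
def Has (s : ℕ) (K : Set (Disj V)) (l : ℕ) (L : QuadSum V) (p : ℤ → Prop) : Prop :=
  HasN K (bd s l) (bd s l) L p

theorem Has.der_empty {s l : ℕ} (h : Has s K l L fun _ => False) : Der K (bd s l) ∅ := by
  obtain ⟨-, S, hS, h⟩ := h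
  obtain rfl : S = ∅ := Finset.eq_empty_of_forall_notMem fun a ha => (hS a ha).2
  exact h

variable {s l l₁ l₂ : ℕ} [hs : Fact (16 ≤ s)]

theorem Has.mono (h : Has s K l₁ L p) (hK : K ⊆ K') (hl : l₁ ≤ l) (hp : ∀ a, p a → q a) :
    Has s K' l L q :=
  HasN.mono h hK (bd_mono hl) (bd_mono hl) hp

theorem Has.imp (h : Has s K l₁ L p) (hp : ∀ a, p a → q a) (hl : l₁ ≤ l := by omega) :
    Has s K l L q :=
  h.mono subset_rfl hl hp

theorem Has.lift (h : Has s K l₁ L p) (hl : l₁ ≤ l := by omega) : Has s K l L p :=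
  h.imp fun _ h => h

theorem pow_four_bound {B X : ℕ} (hB : 16 ≤ B) (hX : X ≤ 2 * B) : 8 * (X + 1) ^ 2 ≤ B ^ 4 := by
  calc 8 * (X + 1) ^ 2 ≤ 8 * (3 * B) ^ 2 := by gcongr; omega
    _ ≤ B ^ 4 := by nlinarith [Nat.mul_le_mul hB hB, sq_nonneg B]

/-- One level pays for a binary operation with `W = B ^ 4`. The exponent `100` leaves room for
`Has.sum`, which needs `B ^ 81`. -/
theorem pow_hundred_bound {B : ℕ} (hB : 16 ≤ B) : B + B + (B ^ 4) ^ 13 ≤ B ^ 100 := by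
  calc B + B + (B ^ 4) ^ 13 ≤ B ^ 52 + B ^ 52 + B ^ 52 := by
        rw [← pow_mul]; gcongr <;> exact Nat.le_self_pow (by omega) B
    _ ≤ B * B ^ 52 := by nlinarith [pow_pos (show 0 < B by omega) 52]
    _ = B ^ 53 := by ring
    _ ≤ _ := Nat.pow_le_pow_right (by omega) (by omega)

theorem Has.sub (hL : Has s K l₁ L p) (hM : Has s K l₂ M q) (hr : ∀ a b, p a → q b → r (a - b))
    (h₁ : l₁ < l := by omega) (h₂ : l₂ < l := by omega) : Has s K l (L - M) r := by
  obtain ⟨l, rfl⟩ := Nat.exists_eq_add_of_lt (Nat.zero_lt_of_lt h₁)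
  rw [zero_add] at *
  have hB := sixteen_le_bd s l
  have := HasN.sub (hL.lift (l := l)) (hM.lift (l := l))
    (pow_four_bound (B := bd s l) hB (by omega)) hr
  have h₃ := pow_hundred_bound hB
  exact this.mono subset_rfl (by rw [bd_succ]; exact h₃) (by rw [bd_succ]; omega) fun _ h => h

theorem Has.add (hL : Has s K l₁ L p) (hM : Has s K l₂ M q) (hr : ∀ a b, p a → q b → r (a + b))
    (h₁ : l₁ < l := by omega) (h₂ : l₂ < l := by omega) : Has s K l (L + M) r := by
  obtain ⟨l, rfl⟩ := Nat.exists_eq_add_of_lt (Nat.zero_lt_of_lt h₁)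
  rw [zero_add] at *
  have hB := sixteen_le_bd s l
  have := HasN.add (hL.lift (l := l)) (hM.lift (l := l))
    (pow_four_bound (B := bd s l) hB (by omega)) hr
  have h₃ := pow_hundred_bound hB
  exact this.mono subset_rfl (by rw [bd_succ]; exact h₃) (by rw [bd_succ]; omega) fun _ h => h

theorem Has.inter (hL : Has s K l₁ L p) (hM : Has s K l₂ L q) (hr : ∀ a, p a → q a → r a)
    (h₁ : l₁ < l := by omega) (h₂ : l₂ < l := by omega) : Has s K l L r := by
  obtain ⟨l, rfl⟩ := Nat.exists_eq_add_of_lt (Nat.zero_lt_of_lt h₁)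
  rw [zero_add] at *
  have hB := sixteen_le_bd s l
  have := HasN.inter (hL.lift (l := l)) (hM.lift (l := l))
    (pow_four_bound (B := bd s l) hB (by omega))
  have h₃ := pow_hundred_bound hB
  exact this.mono subset_rfl (by rw [bd_succ]; exact h₃) (by rw [bd_succ]; omega)
    fun a h => hr a h.1 h.2

theorem Has.cases (hL : Has s K l₁ L p) (hM : nrm M ≤ bd s l₂)
    (h : ∀ a, p a → Has s (Insert.insert {⟨L, a⟩} K) l₂ M q)
    (h₁ : l₁ < l := by omega) (h₂ : l₂ < l := by omega) : Has s K l M q := by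
  obtain ⟨l, rfl⟩ := Nat.exists_eq_add_of_lt (Nat.zero_lt_of_lt h₁)
  rw [zero_add] at *
  have hB := sixteen_le_bd s l
  have h₃ := pow_hundred_bound hB
  have h₄ : bd s l ≤ bd s l ^ 4 := Nat.le_self_pow (by omega) _
  have := HasN.cases (hL.lift (l := l)) (pow_four_bound (B := bd s l) hB (by omega)) h₄
    (hM.trans (bd_mono (by omega))) fun a _ ha => (h a ha).lift (l := l)
  have h₅ : (bd s l ^ 4) ^ 8 ≤ (bd s l ^ 4) ^ 13 :=
    Nat.pow_le_pow_right (by positivity) (by omega)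
  exact this.mono subset_rfl (by rw [bd_succ]; omega) (by rw [bd_succ]; omega) fun _ h => h

theorem Has.sum [Nonempty V] {ι : Type*} [Fintype ι] (p : ℕ → ℤ → Prop) (L : ι → QuadSum V)
    (hI : Fintype.card ι ≤ s) (h₀ : p 0 0) (hs : ∀ c a b, p c a → q b → p (c + 1) (a + b))
    (h : ∀ i, Has s K l₁ (L i) q) (h₁ : l₁ < l := by omega) :
    Has s K l (∑ i, L i) (p (Fintype.card ι)) := by
  obtain ⟨l, rfl⟩ := Nat.exists_eq_add_of_lt (Nat.zero_lt_of_lt h₁)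
  rw [zero_add] at *
  have hB := sixteen_le_bd s l
  have hI' : Fintype.card ι ≤ bd s l := hI.trans (le_bd s l)
  have hIB : Fintype.card ι * bd s l ≤ bd s l ^ 2 := by rw [sq]; gcongr
  generalize hBB : bd s l = B at *
  have hW : 8 * ((Finset.univ : Finset ι).card * B + 1) ^ 2 ≤ B ^ 6 := by
    rw [Finset.card_univ]
    calc _ ≤ 8 * (B ^ 2 + B ^ 2) ^ 2 := by gcongr; nlinarith
      _ = 32 * B ^ 4 := by ring
      _ ≤ B ^ 2 * B ^ 4 := by gcongr; nlinarith
      _ = _ := by ring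
  have := HasN.sum Finset.univ L p hW h₀ hs fun i _ => by
    have := (h i).lift (l := l)
    rwa [Has, hBB] at this
  rw [Finset.card_univ] at this
  have hp : 1 ≤ B := by omega
  refine this.mono subset_rfl ?_ ?_ fun _ h => h
  · rw [bd_succ, hBB]
    have b₁ : 8 ^ 8 ≤ B ^ 80 := calc
      8 ^ 8 = 16 ^ 6 := by norm_num
      _ ≤ B ^ 6 := Nat.pow_le_pow_left hB 6
      _ ≤ B ^ 80 := Nat.pow_le_pow_right hp (by omega)
    have b₂ : B + (B ^ 6) ^ 13 ≤ B ^ 78 + B ^ 78 := by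
      rw [← pow_mul]
      exact Nat.add_le_add_right (Nat.le_self_pow (by omega) B) _
    calc 8 ^ 8 + Fintype.card ι * (B + (B ^ 6) ^ 13) ≤ B ^ 80 + B * (B ^ 78 + B ^ 78) :=
          Nat.add_le_add b₁ (Nat.mul_le_mul hI' b₂)
      _ = B ^ 80 + 2 * B ^ 79 := by ring
      _ ≤ B ^ 80 + B * B ^ 79 := by gcongr; omega
      _ = 2 * B ^ 80 := by ring
      _ ≤ B * B ^ 80 := by gcongr; omega
      _ = B ^ 81 := by ring
      _ ≤ B ^ 100 := Nat.pow_le_pow_right hp (by omega)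
  · rw [bd_succ, hBB]
    exact hIB.trans (Nat.pow_le_pow_right hp (by omega))

theorem Has.of_step {S : Finset ℤ} (h : Step K [] (mem L S)) (hL : nrm L ≤ bd s l₁)
    (hS : ∀ a ∈ S, |a| ≤ (bd s l₁ : ℤ) ∧ p a) (h₁ : l₁ < l := by omega) : Has s K l L p := by
  obtain ⟨l, rfl⟩ := Nat.exists_eq_add_of_lt (Nat.zero_lt_of_lt h₁)
  rw [zero_add] at *
  have hB := sixteen_le_bd s l
  have h₃ := pow_hundred_bound hB
  have hl : bd s l₁ ≤ bd s l := bd_mono (by omega)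
  have hw := (wt_mem_le hL fun a ha => (hS a ha).1).trans
    (pow_four_bound (B := bd s l) hB (by omega))
  have h₄ : bd s l ^ 4 ≤ (bd s l ^ 4) ^ 13 := Nat.le_self_pow (by omega) _
  have hl' : bd s l ≤ bd s (l + 1) := bd_mono (by omega)
  refine ⟨by omega, S, fun a ha => ⟨(hS a ha).1.trans (by norm_cast; omega), (hS a ha).2⟩,
    (Der.of_step h).mono subset_rfl ?_⟩
  rw [bd_succ]
  omega

theorem Has.of_mem {S : Finset ℤ} (h : mem L S ∈ K) (hL : nrm L ≤ bd s l₁)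
    (hS : ∀ a ∈ S, |a| ≤ (bd s l₁ : ℤ) ∧ p a) (h₁ : l₁ < l := by omega) : Has s K l L p :=
  .of_step (.hyp _ h) hL hS h₁

theorem Has.of_insert {a : ℤ} (hL : nrm L ≤ bd s l₁) (ha : |a| ≤ (bd s l₁ : ℤ))
    (h₁ : l₁ < l := by omega) : Has s (Insert.insert {⟨L, a⟩} K) l L (· = a) :=
  .of_mem (S := {a}) (by rw [mem_singleton]; exact Set.mem_insert _ _) hL (by simpa using ha)

/-- Elimination of a disjunct which is refuted by an equation at hand. -/
theorem Has.of_or {S : Finset ℤ} {a b : ℤ} (h : mem L S ∪ {⟨M, b⟩} ∈ K) (hM : {⟨M, a⟩} ∈ K)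
    (hab : b ≠ a) (hL : nrm L ≤ bd s l₁) (hM' : nrm M ≤ bd s l₁)
    (ha : |a| ≤ (bd s l₁ : ℤ)) (hb : |b| ≤ (bd s l₁ : ℤ))
    (hS : ∀ a ∈ S, |a| ≤ (bd s l₁ : ℤ) ∧ p a) (h₁ : l₁ < l := by omega) : Has s K l L p := by
  obtain ⟨l, rfl⟩ := Nat.exists_eq_add_of_lt (Nat.zero_lt_of_lt h₁)
  rw [zero_add] at *
  have hB := sixteen_le_bd s l
  have h₃ := pow_hundred_bound hB
  have hl : bd s l₁ ≤ bd s l := bd_mono (by omega)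
  have hw := (wt_mem_le hL fun a ha => (hS a ha).1).trans
    (pow_four_bound (B := bd s l) hB (by omega))
  have hl' : bd s l ≤ bd s (l + 1) := bd_mono (by omega)
  refine ⟨by omega, S, fun a ha => ⟨(hS a ha).1.trans (by norm_cast; omega), (hS a ha).2⟩, ?_⟩
  have d₁ := Der.hyp h
  have d₂ := Der.hyp hM
  have w₁ := wt_union_lt (mem L S) {⟨M, b⟩}
  rw [wt_eq_singleton] at w₁ d₂
  rw [Finset.union_comm, ← Finset.insert_eq] at d₁ w₁
  have d₃ := Der.resolve (B := ∅) d₁ d₂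
  -- The left sides cancel, and simplification deletes the false disjunct `0 = b - a`.
  have e : (⟨M, b⟩ : QuadEq V) - ⟨M, a⟩ = ⟨0, b - a⟩ :=
    QuadEq.ext (sub_self M) rfl
  rw [e, Finset.union_empty] at d₃
  refine (Der.simplify (sub_ne_zero.2 hab) d₃).mono subset_rfl ?_
  have w₂ := wt_union_lt (mem L S) {⟨0, b - a⟩}
  rw [wt_eq_singleton, nrm_zero, Finset.union_comm, ← Finset.insert_eq] at w₂
  have i₁ := natAbs_le_of_abs_le ha
  have i₂ := natAbs_le_of_abs_le hb
  have i₃ : (b - a).natAbs ≤ bd s l₁ + bd s l₁ := by omega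
  have h₄ : 8 * bd s l ^ 4 ≤ (bd s l ^ 4) ^ 13 := by
    have : bd s l ^ 4 ≤ bd s l ^ 48 := Nat.pow_le_pow_right (by omega) (by omega)
    have : 8 ≤ bd s l ^ 4 := le_trans (by norm_num) (Nat.pow_le_pow_left hB 4)
    calc 8 * bd s l ^ 4 ≤ bd s l ^ 4 * bd s l ^ 48 := by gcongr
      _ = _ := by ring
  have h₅ : 8 * bd s l + 10 ≤ bd s l ^ 4 :=
    le_trans (by nlinarith) (pow_four_bound (X := bd s l) hB (by omega))
  rw [bd_succ]
  omega

end RQuad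

/-! ### Sums with a common property, bits, and provable products. -/

namespace RQuad

variable {V : Type} {K : Set (Disj V)} {s l l₁ : ℕ} [Fact (16 ≤ s)] {L : QuadSum V}

theorem Has.sum_add [Nonempty V] {ι : Type*} [Fintype ι] {p : ℤ → Prop} {L : ι → QuadSum V}
    (hI : Fintype.card ι ≤ s) (h : ∀ i, Has s K l₁ (L i) p) (h₀ : p 0)
    (hadd : ∀ a b, p a → p b → p (a + b)) (h₁ : l₁ < l := by omega) :
    Has s K l (∑ i, L i) p :=
  Has.sum (fun _ => p) L hI h₀ (fun _ => hadd) h h₁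

theorem Has.sum_eq_zero [Nonempty V] {ι : Type*} [Fintype ι] {L : ι → QuadSum V}
    (hI : Fintype.card ι ≤ s) (h : ∀ i, Has s K l₁ (L i) (· = 0)) (h₁ : l₁ < l := by omega) :
    Has s K l (∑ i, L i) (· = 0) :=
  Has.sum_add hI h rfl (by rintro _ _ rfl rfl; rfl) h₁

theorem Has.sum_even [Nonempty V] {ι : Type*} [Fintype ι] {L : ι → QuadSum V}
    (hI : Fintype.card ι ≤ s) (h : ∀ i, Has s K l₁ (L i) Even) (h₁ : l₁ < l := by omega) :
    Has s K l (∑ i, L i) Even :=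
  Has.sum_add hI h Even.zero (fun _ _ => Even.add) h₁

theorem Has.sum_nonneg [Nonempty V] {ι : Type*} [Fintype ι] {L : ι → QuadSum V}
    (hI : Fintype.card ι ≤ s) (h : ∀ i, Has s K l₁ (L i) (0 ≤ ·)) (h₁ : l₁ < l := by omega) :
    Has s K l (∑ i, L i) (0 ≤ ·) :=
  Has.sum_add hI h le_rfl (fun _ _ => add_nonneg) h₁

theorem Has.sum_le [Nonempty V] {ι : Type*} [Fintype ι] {L : ι → QuadSum V} {b : ℤ}
    (hI : Fintype.card ι ≤ s) (h : ∀ i, Has s K l₁ (L i) (· ≤ b)) (h₁ : l₁ < l := by omega) :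
    Has s K l (∑ i, L i) (· ≤ Fintype.card ι * b) :=
  Has.sum (fun c a => a ≤ c * b) L hI (by simp)
    (fun c a a' (h : a ≤ c * b) (h' : a' ≤ b) => by push_cast; linarith) h h₁

theorem Has.le_sum [Nonempty V] {ι : Type*} [Fintype ι] {L : ι → QuadSum V} {b : ℤ}
    (hI : Fintype.card ι ≤ s) (h : ∀ i, Has s K l₁ (L i) (b ≤ ·)) (h₁ : l₁ < l := by omega) :
    Has s K l (∑ i, L i) (Fintype.card ι * b ≤ ·) :=
  Has.sum (fun c a => c * b ≤ a) L hI (by simp)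
    (fun c a a' (h : c * b ≤ a) (h' : b ≤ a') => by push_cast; linarith) h h₁

theorem Has.sum_eq_card [Nonempty V] {ι : Type*} [Fintype ι] {L : ι → QuadSum V}
    (hI : Fintype.card ι ≤ s) (h : ∀ i, Has s K l₁ (L i) (· = 1)) (h₁ : l₁ < l := by omega) :
    Has s K l (∑ i, L i) (· = Fintype.card ι) :=
  Has.sum (fun c a => a = c) L hI (by simp) (by rintro c _ _ rfl rfl; push_cast; rfl) h h₁

/-- An integer is `0` or `1`. -/
def Bit (a : ℤ) : Prop := a = 0 ∨ a = 1

theorem Has.of_step_bit (h : Step K [] (mem L {0, 1})) (hL : nrm L ≤ 16) : Has s K 1 L Bit := by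
  have hB := sixteen_le_bd s 0
  refine .of_step (l₁ := 0) h (hL.trans hB) fun a ha => ?_
  have ha : a = 0 ∨ a = 1 := by simpa using ha
  refine ⟨?_, ha⟩
  rcases ha with rfl | rfl
  · simp
  · rw [abs_one]; norm_cast; omega

theorem Has.var (v : V) : Has s K 1 (var v) Bit := .of_step_bit (.boolVar v) (by simp)

/-- Case analysis on the value of a variable. -/
theorem Has.cases_var (v : V) {p : ℤ → Prop} (hL : nrm L ≤ bd s l₁)
    (h₀ : ∀ K' : Set (Disj V), K ⊆ K' → {⟨RQuad.var v, 0⟩} ∈ K' →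
      Has s K' 1 (RQuad.var v) (· = 0) → Has s K' l₁ L p)
    (h₁ : ∀ K' : Set (Disj V), K ⊆ K' → {⟨RQuad.var v, 1⟩} ∈ K' →
      Has s K' 1 (RQuad.var v) (· = 1) → Has s K' l₁ L p)
    (hl : l₁ < l := by omega) (hl' : 1 < l := by omega) : Has s K l L p := by
  have hB := sixteen_le_bd s 0
  refine Has.cases (Has.var v) hL (fun a ha => ?_) hl' hl
  rcases ha with rfl | rfl
  · refine h₀ _ (Set.subset_insert _ _) (Set.mem_insert _ _) (.of_insert (l₁ := 0) ?_ ?_)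
    · rw [nrm_var]; omega
    · simp
  · refine h₁ _ (Set.subset_insert _ _) (Set.mem_insert _ _) (.of_insert (l₁ := 0) ?_ ?_)
    · rw [nrm_var]; omega
    · rw [abs_one]; norm_cast; omega

/-- The values of `e` are, provably, the products of the values of `a` and of `b`, for `0`-`1`-valued
quadratic sums `a` and `b`. -/
structure IsProd (s : ℕ) (K : Set (Disj V)) (a b e : QuadSum V) : Prop where
  bit : Has s K 1 e Bit
  left : Has s K 1 (a - e) Bit
  right : Has s K 1 (b - e) Bit
  add : Has s K 1 (a + b - e) Bit

variable {a b e : QuadSum V}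

theorem nrm_sub_var_le (L : QuadSum V) (v : V) : nrm (L - var v) ≤ nrm L + 1 := by
  simpa using nrm_sub_le L (var v)

theorem nrm_var_add_var_sub_le (u v w : V) : nrm (var u + var v - var w) ≤ 16 := by
  have h₁ := nrm_sub_var_le (var u + var v) w
  have h₂ := nrm_add_le (var u) (var v)
  simp only [nrm_var] at h₂
  omega

theorem isProd_prod (v w : V) : IsProd s K (var v) (var w) (prod v w) where
  bit := .of_step_bit (.boolProd v w) (by simp)
  left := .of_step_bit (.boolDiff v w) ((nrm_sub_le _ _).trans (by simp))
  right := by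
    have : prod v w = prod w v := by rw [prod, prod, Sym2.eq_swap]
    rw [this]
    exact .of_step_bit (.boolDiff w v) ((nrm_sub_le _ _).trans (by simp))
  add := .of_step_bit (.boolOr v w) (by
    have h₁ := nrm_sub_le (var v + var w) (prod v w)
    have h₂ := nrm_add_le (var v) (var w)
    simp only [nrm_var, nrm_prod] at h₁ h₂
    omega)

theorem isProd_var {u v w : V} (h₁ : mem (var u - var w) {0, 1} ∈ K)
    (h₂ : mem (var v - var w) {0, 1} ∈ K) (h₃ : mem (var u + var v - var w) {0, 1} ∈ K) :
    IsProd s K (var u) (var v) (var w) where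
  bit := .var w
  left := .of_step_bit (.hyp _ h₁) ((nrm_sub_var_le _ _).trans (by simp))
  right := .of_step_bit (.hyp _ h₂) ((nrm_sub_var_le _ _).trans (by simp))
  add := .of_step_bit (.hyp _ h₃) (nrm_var_add_var_sub_le _ _ _)

theorem IsProd.symm {s : ℕ} (h : IsProd s K a b e) : IsProd s K b a e :=
  ⟨h.bit, h.right, h.left, add_comm a b ▸ h.add⟩

theorem IsProd.mono {K' : Set (Disj V)} (h : IsProd s K a b e) (hK : K ⊆ K') :
    IsProd s K' a b e :=
  ⟨h.bit.mono hK le_rfl fun _ h => h, h.left.mono hK le_rfl fun _ h => h,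
    h.right.mono hK le_rfl fun _ h => h, h.add.mono hK le_rfl fun _ h => h⟩

/-- From `a = 0` and the bit `a - e`, the value of `e` is `0` or `-1`; being a bit, it is `0`. -/
theorem IsProd.eq_zero (h : IsProd s K a b e) (ha : Has s K l₁ a (· = 0))
    (hl : l₁ + 1 < l := by omega) (hl' : 2 < l := by omega) : Has s K l e (· = 0) := by
  have h₁ : Has s K (l - 1) (a - (a - e)) (fun x => x = 0 ∨ x = -1) :=
    ha.sub h.left (by rintro _ _ rfl (rfl | rfl) <;> simp)
  rw [sub_sub_cancel] at h₁
  exact h₁.inter h.bit (by rintro _ (rfl | rfl) (h | h) <;> omega)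

/-- Subtracting `a = 1` from the bit `a + b - e` leaves `b - e` in `{-1, 0}`, and `b - e` is itself
a bit. -/
theorem IsProd.sub_eq_zero (h : IsProd s K a b e) (ha : Has s K l₁ a (· = 1))
    (hl : l₁ + 1 < l := by omega) (hl' : 2 < l := by omega) : Has s K l (b - e) (· = 0) := by
  have h₁ : Has s K (l - 1) (a + b - e - a) (fun x => x = 0 ∨ x = -1) :=
    h.add.sub ha (by rintro _ _ (rfl | rfl) rfl <;> simp)
  rw [show a + b - e - a = b - e by abel] at h₁
  exact h₁.inter h.right (by rintro _ (rfl | rfl) (h | h) <;> omega)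

theorem Has.sub_zero {M : QuadSum V} {l₂ : ℕ} (hL : Has s K l₁ L (· = 0))
    (hM : Has s K l₂ M (· = 0)) (h₁ : l₁ < l := by omega) (h₂ : l₂ < l := by omega) :
    Has s K l (L - M) (· = 0) :=
  hL.sub hM (by rintro _ _ rfl rfl; rfl)

/-- Uniqueness of products. -/
theorem IsProd.unique {v : V} {f : QuadSum V} (h : IsProd s K (var v) b e)
    (h' : IsProd s K (var v) b f) (hn : nrm (e - f) ≤ 16) : Has s K 5 (e - f) (· = 0) := by
  refine .cases_var v (l₁ := 4) (hn.trans (sixteen_le_bd _ _)) (fun K' hK _ hv => ?_)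
    fun K' hK _ hv => ?_
  · exact ((h.mono hK).eq_zero hv (l := 3)).sub_zero ((h'.mono hK).eq_zero hv (l := 3))
  · rw [← sub_sub_sub_cancel_left f e b]
    exact ((h'.mono hK).sub_eq_zero hv (l := 3)).sub_zero ((h.mono hK).sub_eq_zero hv (l := 3))

/-- Associativity of products. -/
theorem IsProd.assoc {y z : V} {x p q f : QuadSum V} (hp : IsProd s K (var y) x p)
    (hq : IsProd s K x (var z) q) (he : IsProd s K (var y) q e) (hf : IsProd s K (var z) p f)
    (hn : nrm (e - f) ≤ 16) : Has s K 7 (e - f) (· = 0) := by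
  have hn' := fun l => hn.trans (sixteen_le_bd s l)
  -- Splitting on the variables `y` and `z` suffices, as `x` cancels in every case. The cubic `y x
  -- z` is never written.
  refine .cases_var y (l₁ := 6) (hn' _) (fun K' hK _ hy => ?_) fun K' hK _ hy => ?_
  · have h₁ := (hp.mono hK).eq_zero hy (l := 3)
    exact ((he.mono hK).eq_zero hy (l := 3)).sub_zero ((hf.mono hK).symm.eq_zero h₁ (l := 5))
  · have h₁ := (he.mono hK).sub_eq_zero hy (l := 3)
    have h₂ := (hp.mono hK).sub_eq_zero hy (l := 3)
    refine .cases_var z (l₁ := 5) (hn' _) (fun K₂ hK₂ _ hz => ?_) fun K₂ hK₂ _ hz => ?_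
    · have h₃ := (hf.mono (hK.trans hK₂)).eq_zero hz (l := 3)
      have h₄ := (hq.mono (hK.trans hK₂)).symm.eq_zero hz (l := 3)
      have h₅ := h₄.sub_zero (l := 4) (h₁.mono hK₂ le_rfl fun _ h => h)
      rw [sub_sub_cancel] at h₅
      exact h₅.sub_zero h₃
    · have h₃ := (hf.mono (hK.trans hK₂)).sub_eq_zero hz (l := 3)
      have h₄ := (hq.mono (hK.trans hK₂)).symm.sub_eq_zero hz (l := 3)
      have h₅ := (h₂.mono hK₂ le_rfl fun _ h => h).sub_zero (l := 4) h₄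
      have h₆ := (h₁.mono hK₂ le_rfl fun _ h => h).sub_zero (l := 4) h₃
      rw [show e - f = x - p - (x - q) - (q - e - (p - f)) by abel]
      exact h₅.sub_zero h₆

theorem Has.two_var (v : V) : Has s K 3 (RQuad.var v + RQuad.var v) Even := by
  refine .cases_var v (l₁ := 2) ?_ (fun K' hK _ hv => ?_) fun K' hK _ hv => ?_
  · have h₁ := sixteen_le_bd s 2
    have h₂ := nrm_add_le (RQuad.var v) (RQuad.var v)
    simp only [nrm_var] at h₂
    omega
  all_goals exact hv.add hv (by rintro _ _ rfl rfl; decide)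

/-- The shape of the number of true literals of a clause, and of its multiples. -/
def comb {n : ℕ} (f g e : Fin 3 → Fin n → QuadSum V) : QuadSum V :=
  ∑ h, (∑ i, f h i + ∑ i, (g h i - e h i))

/-- `U r`, `yU a j r` and `zYX a j r` all have this shape, so they can be compared term by term. -/
theorem comb_sub {n : ℕ} (f g e f' g' e' : Fin 3 → Fin n → QuadSum V) :
    comb f g e - comb f' g' e' =
      comb (fun h i => f h i - f' h i) (fun h i => g h i - g' h i) (fun h i => e h i - e' h i) := by
  simp only [comb, ← Finset.sum_sub_distrib, ← Finset.sum_add_distrib]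
  refine Finset.sum_congr rfl fun h _ => Finset.sum_congr rfl fun i _ => ?_
  abel

theorem nrm_comb_le {n : ℕ} {f g e : Fin 3 → Fin n → QuadSum V} (hf : ∀ h i, nrm (f h i) ≤ 1)
    (hg : ∀ h i, nrm (g h i) ≤ 1) (he : ∀ h i, nrm (e h i) ≤ 1) : nrm (comb f g e) ≤ 9 * n := by
  have h : ∀ h, nrm (∑ i, f h i + ∑ i, (g h i - e h i)) ≤ n * 1 + n * 2 := fun h => by
    refine (nrm_add_le _ _).trans (Nat.add_le_add ?_ ?_)
    · simpa using nrm_univ_sum_le (f h) (hf h)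
    · simpa using nrm_univ_sum_le (fun i => g h i - e h i) (b := 2) fun i =>
        (nrm_sub_le _ _).trans (Nat.add_le_add (hg h i) (he h i))
  have := nrm_univ_sum_le _ h
  rw [Fintype.card_fin] at this
  exact this.trans (by omega)

theorem Has.comb_eq_zero [Nonempty V] {n : ℕ} (hn : n ≤ s) {f g e : Fin 3 → Fin n → QuadSum V}
    (hf : ∀ h i, Has s K l₁ (f h i) (· = 0)) (hg : ∀ h i, Has s K l₁ (g h i) (· = 0))
    (he : ∀ h i, Has s K l₁ (e h i) (· = 0)) (hl : l₁ + 3 < l := by omega) :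
    Has s K l (comb f g e) (· = 0) := by
  have hs : 16 ≤ s := Fact.out
  have hn' : Fintype.card (Fin n) ≤ s := by simpa using hn
  have h₁ : ∀ h, Has s K (l₁ + 3) (∑ i, f h i + ∑ i, (g h i - e h i)) (· = 0) := fun h =>
    (Has.sum_eq_zero hn' (hf h) (l := l₁ + 1)).add
      (Has.sum_eq_zero hn' (fun i => (hg h i).sub_zero (he h i) (l := l₁ + 1)) (l := l₁ + 2))
      (by rintro _ _ rfl rfl; rfl)
  exact Has.sum_eq_zero (by rw [Fintype.card_fin]; omega) h₁

end RQuad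

/-! ### Parity of the number of satisfied members of a tuple. -/

namespace ThreeXor

open RQuad

variable {n m k t d c s : ℕ} {K : Set (Disj (Var n m k t))}

/-- All parameters of the formula are bounded in terms of `s`. -/
structure Bounded (n m k t d c s : ℕ) : Prop where
  n_le : n ≤ s
  m_le : m ≤ s
  k_le : k ≤ s
  t_le : t ≤ s
  d_le : d ≤ s
  c_le : c ≤ 3 * s

variable [Fact (16 ≤ s)]

theorem isProd_yx (hK : Upsilon n m k t d c ⊆ K) (a : Fin t) (j : Fin k) (r : Fin m) (h : Fin 3)
    (i : Lit n) :
    IsProd s K (var (Var.y a j r)) (var (Var.x r h i)) (var (Var.yx a j r r h i)) :=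
  isProd_var (hK (.yx₁ a j r r h i)) (hK (.yx₂ a j r r h i)) (hK (.yx₃ a j r r h i))

theorem isProd_xz (hK : Upsilon n m k t d c ⊆ K) (r : Fin m) (h : Fin 3) (i : Lit n) (p : Fin n) :
    IsProd s K (var (Var.x r h i)) (var (Var.z p)) (var (Var.xz r h i p)) :=
  isProd_var (hK (.xz₁ r h i p)) (hK (.xz₂ r h i p)) (hK (.xz₃ r h i p))

/-- The number of true literals of clause `r`, multiplied by `y a j r`. -/
def yU (a : Fin t) (j : Fin k) (r : Fin m) : QuadSum (Var n m k t) :=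
  comb (fun h i => prod (.y a j r) (.xz r h (Sum.inl i) i))
    (fun h i => prod (.y a j r) (.x r h (Sum.inr i)))
    fun h i => prod (.y a j r) (.xz r h (Sum.inr i) i)

/-- The sum `yU a j r`, written with the products of `y a j r` and the table entries. -/
def zYX (a : Fin t) (j : Fin k) (r : Fin m) : QuadSum (Var n m k t) :=
  comb (fun h i => prod (.z i) (.yx a j r r h (Sum.inl i)))
    (fun h i => var (.yx a j r r h (Sum.inr i)))
    fun h i => prod (.z i) (.yx a j r r h (Sum.inr i))

theorem nrm_U_le (r : Fin m) : nrm (U r : QuadSum (Var n m k t)) ≤ 9 * n :=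
  nrm_comb_le (by simp) (by simp) (by simp)

theorem nrm_yU_le (a : Fin t) (j : Fin k) (r : Fin m) :
    nrm (yU a j r : QuadSum (Var n m k t)) ≤ 9 * n :=
  nrm_comb_le (by simp) (by simp) (by simp)

theorem sq_le_bd_one : s ^ 2 ≤ bd s 1 := pow_le_bd (by norm_num)

theorem nine_mul_le (hb : Bounded n m k t d c s) : 1 + 9 * n ≤ bd s 1 := by
  have h16 : 16 ≤ s := Fact.out
  have := hb.n_le
  refine le_trans ?_ sq_le_bd_one
  nlinarith

/-- The value of `u r` has the parity of the number of true literals of clause `r`. -/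
theorem has_U_even (hK : Upsilon n m k t d c ⊆ K) (hb : Bounded n m k t d c s) (r : Fin m)
    (hu : {⟨var (Var.u r), 0⟩} ∈ K) : Has s K 2 (U r) Even := by
  have := nine_mul_le hb
  have h16 := sixteen_le_bd s 1
  refine .of_or (l₁ := 1) (hK (.u₁ r)) hu one_ne_zero ((nrm_U_le r).trans (by omega))
    (by simp; omega) (by simp) (by rw [abs_one]; norm_cast; omega) fun a ha => ?_
  have ha : a = 0 ∨ a = 2 := by simpa using ha
  rcases ha with rfl | rfl
  · simp
  · exact ⟨by rw [abs_two]; norm_cast; omega, even_two⟩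

theorem has_U_odd (hK : Upsilon n m k t d c ⊆ K) (hb : Bounded n m k t d c s) (r : Fin m)
    (hu : {⟨var (Var.u r), 1⟩} ∈ K) : Has s K 2 (U r) Odd := by
  have := nine_mul_le hb
  have h16 := sixteen_le_bd s 1
  refine .of_or (l₁ := 1) (hK (.u₀ r)) hu zero_ne_one ((nrm_U_le r).trans (by omega))
    (by simp; omega) (by rw [abs_one]; norm_cast; omega) (by simp) fun a ha => ?_
  have ha : a = 1 ∨ a = 3 := by simpa using ha
  rcases ha with rfl | rfl
  · exact ⟨by rw [abs_one]; norm_cast; omega, odd_one⟩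
  · exact ⟨by rw [abs_of_pos (by norm_num)]; norm_cast; omega, by decide⟩

/-- Both terms vanish if `y a j r = 0`; otherwise they take the values of `u r` and `U r`, which
have equal parity for each value of `u r`. -/
theorem has_yu_sub_yU (hK : Upsilon n m k t d c ⊆ K) (hb : Bounded n m k t d c s) (a : Fin t)
    (j : Fin k) (r : Fin m) : Has s K 11 (prod (.y a j r) (.u r) - yU a j r) Even := by
  have : Nonempty (Var n m k t) := ⟨.u r⟩
  have hn : ∀ l, 1 ≤ l → nrm (prod (.y a j r) (.u r) - yU a j r : QuadSum (Var n m k t)) ≤ bd s l :=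
    fun l hl => by
      refine ((nrm_sub_le _ _).trans ?_).trans (bd_mono hl)
      rw [nrm_prod]
      exact (Nat.add_le_add_left (nrm_yU_le a j r) 1).trans (nine_mul_le hb)
  refine .cases_var (.y a j r) (l₁ := 10) (hn _ (by omega)) (fun K₁ hK₁ _ hy => ?_)
    fun K₁ hK₁ _ hy => ?_
  · have h₁ : Has s K₁ 7 (yU a j r) (· = 0) :=
      Has.comb_eq_zero hb.n_le (fun h i => (isProd_prod _ _).eq_zero hy (l := 3))
        (fun h i => (isProd_prod _ _).eq_zero hy) fun h i => (isProd_prod _ _).eq_zero hy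
    exact (((isProd_prod _ _).eq_zero hy (l := 3)).sub_zero h₁ (l := 8)).imp (by rintro _ rfl; simp)
  · have h₁ : Has s K₁ 7 (U r - yU a j r) (· = 0) := by
      rw [yU, U]
      change Has s K₁ 7 (comb _ _ _ - comb _ _ _) _
      rw [comb_sub]
      exact Has.comb_eq_zero hb.n_le (fun h i => (isProd_prod _ _).sub_eq_zero hy (l := 3))
        (fun h i => (isProd_prod _ _).sub_eq_zero hy) fun h i => (isProd_prod _ _).sub_eq_zero hy
    refine .cases_var (.u r) (l₁ := 9) (hn _ (by omega)) (fun K₂ hK₂ hm hu => ?_)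
      fun K₂ hK₂ hm hu => ?_
    · have h₂ := has_U_even (hK.trans (hK₁.trans hK₂)) hb r hm
      have h₃ := h₂.sub (l := 8) (r := Even) (h₁.mono hK₂ le_rfl fun _ h => h)
        (by rintro _ _ h rfl; simpa using h)
      rw [sub_sub_cancel] at h₃
      exact ((isProd_prod _ _).symm.eq_zero hu (l := 3)).sub h₃ (by rintro _ _ rfl h; simpa using h)
    · have h₂ := has_U_odd (hK.trans (hK₁.trans hK₂)) hb r hm
      have h₃ := h₂.sub (l := 8) (r := Odd) (h₁.mono hK₂ le_rfl fun _ h => h)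
        (by rintro _ _ h rfl; simpa using h)
      rw [sub_sub_cancel] at h₃
      have h₄ := (isProd_prod (s := s) (K := K₂) (.y a j r) (.u r)).sub_eq_zero
        (hy.mono hK₂ le_rfl fun _ h => h) (l := 3)
      have h₅ := hu.sub (l := 4) (r := Odd) h₄ (by rintro _ _ rfl rfl; decide)
      rw [sub_sub_cancel] at h₅
      exact h₅.sub h₃ fun _ _ => Odd.sub_odd

/-- Termwise: associativity handles the products with `xz`, uniqueness of products those with `x`.
-/
theorem has_yU_sub_zYX (hK : Upsilon n m k t d c ⊆ K) (hb : Bounded n m k t d c s) (a : Fin t)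
    (j : Fin k) (r : Fin m) : Has s K 11 (yU a j r - zYX a j r) (· = 0) := by
  have : Nonempty (Var n m k t) := ⟨.u r⟩
  rw [yU, zYX, comb_sub]
  have hn : ∀ v w v' w' : Var n m k t, nrm (prod v w - prod v' w') ≤ 16 := fun v w v' w' =>
    (nrm_sub_le _ _).trans (by simp)
  have hn' : ∀ v w v' : Var n m k t, nrm (prod v w - var v') ≤ 16 := fun v w v' =>
    (nrm_sub_le _ _).trans (by simp)
  exact Has.comb_eq_zero hb.n_le
    (fun h i => (isProd_yx hK a j r h _).assoc (isProd_xz hK r h _ i) (isProd_prod _ _)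
      (isProd_prod _ _) (hn _ _ _ _))
    (fun h i => ((isProd_prod _ _).unique (isProd_yx hK a j r h _) (hn' _ _ _)).lift)
    fun h i => (isProd_yx hK a j r h _).assoc (isProd_xz hK r h _ i) (isProd_prod _ _)
      (isProd_prod _ _) (hn _ _ _ _)

theorem nrm_sum₃_le {V : Type} {n₁ n₂ n₃ b : ℕ} (L : Fin n₁ → Fin n₂ → Fin n₃ → QuadSum V)
    (h : ∀ i₁ i₂ i₃, nrm (L i₁ i₂ i₃) ≤ b) :
    nrm (∑ i₁, ∑ i₂, ∑ i₃, L i₁ i₂ i₃) ≤ n₁ * (n₂ * (n₃ * b)) := by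
  have h₁ := nrm_univ_sum_le _ fun i₁ => nrm_univ_sum_le _ fun i₂ => nrm_univ_sum_le _ (h i₁ i₂)
  simpa only [Fintype.card_fin] using h₁

theorem cubic_le_bd {n₁ n₂ b : ℕ} (h₁ : n₁ ≤ s) (h₂ : n₂ ≤ s) (hb : b ≤ s) :
    n₁ * (3 * (n₂ * b)) ≤ bd s 1 := by
  have h16 : 16 ≤ s := Fact.out
  refine le_trans ?_ (pow_le_bd (s := s) (e := 4) (by norm_num))
  calc n₁ * (3 * (n₂ * b)) ≤ s * (s * (s * s)) := by gcongr; omega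
    _ = s ^ 4 := by ring

theorem c_le_bd (hb : Bounded n m k t d c s) : (c : ℤ) ≤ bd s 1 := by
  have h16 : 16 ≤ s := Fact.out
  have h₁ := hb.c_le
  have : c ≤ bd s 1 := le_trans (by nlinarith) sq_le_bd_one
  exact_mod_cast this

/-- The contribution of the variable `i` to the multiple of the number of true literals is even. -/
theorem has_even (hK : Upsilon n m k t d c ⊆ K) (hb : Bounded n m k t d c s) (a : Fin t)
    (i : Fin n) :
    Has s K 9 (∑ j : Fin k, ∑ h : Fin 3, ∑ r : Fin m,
      (prod (.z i) (.yx a j r r h (Sum.inl i)) - prod (.z i) (.yx a j r r h (Sum.inr i)))) Even := by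
  have : Nonempty (Var n m k t) := ⟨.z i⟩
  have h16 : 16 ≤ s := Fact.out
  have hk : Fintype.card (Fin k) ≤ s := by simpa using hb.k_le
  have hm : Fintype.card (Fin m) ≤ s := by simpa using hb.m_le
  have h3 : Fintype.card (Fin 3) ≤ s := by rw [Fintype.card_fin]; omega
  refine .cases_var (.z i) (l₁ := 8) ?_ (fun K₁ hK₁ _ hz => ?_) fun K₁ hK₁ _ hz => ?_
  · exact ((nrm_sum₃_le _ fun j h r => (nrm_sub_le _ _).trans (by simp)).trans
      (cubic_le_bd hb.k_le hb.m_le (b := 2) (by omega))).trans (bd_mono (by omega))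
  · refine (Has.sum_eq_zero (l := 7) (l₁ := 6) hk fun j => Has.sum_eq_zero (l₁ := 5) h3 fun h =>
      Has.sum_eq_zero (l₁ := 4) hm fun r => ?_).imp (by rintro _ rfl; simp)
    exact ((isProd_prod _ _).eq_zero hz (l := 3)).sub_zero ((isProd_prod _ _).eq_zero hz (l := 3))
  · have h₁ : Has s K₁ 7 (∑ j : Fin k, ∑ h : Fin 3, ∑ r : Fin m,
        ((var (.yx a j r r h (Sum.inl i)) - prod (.z i) (.yx a j r r h (Sum.inl i))) -
        (var (.yx a j r r h (Sum.inr i)) - prod (.z i) (.yx a j r r h (Sum.inr i))))) (· = 0) :=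
      Has.sum_eq_zero (l₁ := 6) hk fun j => Has.sum_eq_zero (l₁ := 5) h3 fun h =>
        Has.sum_eq_zero (l₁ := 4) hm fun r =>
          ((isProd_prod _ _).sub_eq_zero hz (l := 3)).sub_zero
            ((isProd_prod _ _).sub_eq_zero hz (l := 3))
    -- With `z_i = 1` the sum equals `P_i - N_i = (P_i + N_i) - 2 N_i`; here `2 N_i` is even, and
    -- `h₃` is the hypothesis on `P_i + N_i`.
    have h₂ : Has s K₁ 6 (∑ j : Fin k, ∑ h : Fin 3, ∑ r : Fin m,
        (var (.yx a j r r h (Sum.inr i)) + var (.yx a j r r h (Sum.inr i)))) Even :=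
      Has.sum_even (l₁ := 5) hk fun j => Has.sum_even (l₁ := 4) h3 fun h =>
        Has.sum_even (l₁ := 3) hm fun r => Has.two_var _
    have h₃ : Has s K₁ 2 (∑ j : Fin k, ∑ h : Fin 3, (Q a j h (Sum.inl i) + Q a j h (Sum.inr i)))
        Even := by
      refine .of_mem (l₁ := 1) (hK₁ (hK (.even a i))) ?_ fun b hb' => ?_
      · simp only [Q, ← Finset.sum_add_distrib]
        exact (nrm_sum₃_le _ fun j h r => (nrm_add_le _ _).trans (by simp)).trans
          (cubic_le_bd hb.k_le hb.m_le (b := 2) (by omega))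
      · simp only [evens, Finset.mem_filter, Finset.mem_Icc] at hb'
        refine ⟨?_, hb'.2⟩
        rw [abs_of_nonneg hb'.1.1]
        exact hb'.1.2.trans (c_le_bd hb)
    have h₄ := (h₃.sub h₂ (l := 7) (r := Even) fun _ _ => Even.sub).sub h₁ (l := 8) (r := Even)
      (by rintro _ _ h rfl; simpa using h)
    convert h₄ using 1
    simp only [Q, ← Finset.sum_add_distrib, ← Finset.sum_sub_distrib]
    refine Finset.sum_congr rfl fun j _ => Finset.sum_congr rfl fun h _ =>
      Finset.sum_congr rfl fun r _ => ?_
    abel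

theorem has_inconsistent (hK : Upsilon n m k t d c ⊆ K) (hb : Bounded n m k t d c s) (a : Fin t) :
    Has s K 2 (∑ j : Fin k, ∑ h : Fin 3, ∑ i : Fin n, Q a j h (Sum.inr i)) Odd := by
  refine .of_mem (l₁ := 1) (hK (.inconsistent a)) ?_ fun b hb' => ?_
  · refine (nrm_sum₃_le (b := m) _ fun j h i => ?_).trans (cubic_le_bd hb.k_le hb.n_le hb.m_le)
    simpa [Q] using nrm_univ_sum_le (fun r => var (Var.yx a j r r h (Sum.inr i))) (b := 1) (by simp)
  · simp only [odds, Finset.mem_filter, Finset.mem_Icc] at hb'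
    refine ⟨?_, hb'.2⟩
    rw [abs_of_nonneg hb'.1.1]
    exact hb'.1.2.trans (c_le_bd hb)

/-- The count of true literals, regrouped from clauses to variables: `∑ z_i (P_i - N_i) + ∑ N_i`. -/
theorem sum_zYX (a : Fin t) :
    ∑ j : Fin k, ∑ r : Fin m, (zYX a j r : QuadSum (Var n m k t)) =
      ∑ i : Fin n, ∑ j : Fin k, ∑ h : Fin 3, ∑ r : Fin m,
        (prod (.z i) (.yx a j r r h (Sum.inl i)) - prod (.z i) (.yx a j r r h (Sum.inr i))) +
      ∑ j : Fin k, ∑ h : Fin 3, ∑ i : Fin n, Q a j h (Sum.inr i) := by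
  rw [Finset.sum_comm (s := (Finset.univ : Finset (Fin n))), ← Finset.sum_add_distrib]
  refine Finset.sum_congr rfl fun j _ => ?_
  rw [Finset.sum_comm (s := (Finset.univ : Finset (Fin n))), ← Finset.sum_add_distrib]
  simp only [zYX, comb]
  rw [Finset.sum_comm]
  refine Finset.sum_congr rfl fun h _ => ?_
  simp only [Q, ← Finset.sum_add_distrib]
  rw [Finset.sum_comm]
  refine Finset.sum_congr rfl fun i _ => Finset.sum_congr rfl fun r _ => ?_
  abel

/-- The number of members of a tuple that are satisfied as 3XORs is odd. -/
theorem has_satisfied_odd (hK : Upsilon n m k t d c ⊆ K) (hb : Bounded n m k t d c s)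
    [Nonempty (Var n m k t)] (a : Fin t) :
    Has s K 15 (∑ j : Fin k, ∑ r : Fin m, prod (.y a j r) (.u r)) Odd := by
  have hk : Fintype.card (Fin k) ≤ s := by simpa using hb.k_le
  have hm : Fintype.card (Fin m) ≤ s := by simpa using hb.m_le
  have hn : Fintype.card (Fin n) ≤ s := by simpa using hb.n_le
  -- The product `y u` is split as `(y u - yU) + (yU - zYX) + zYX`; the first two parts are even.
  have h₁ : Has s K 14 (∑ j : Fin k, ∑ r : Fin m,
      (prod (.y a j r) (.u r) - yU a j r + (yU a j r - zYX a j r))) Even :=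
    Has.sum_even (l₁ := 13) hk fun j => Has.sum_even (l₁ := 12) hm fun r =>
      (has_yu_sub_yU hK hb a j r).add (has_yU_sub_zYX hK hb a j r)
        (by rintro _ _ h rfl; simpa using h)
  have h₂ := (Has.sum_even (l := 10) hn (has_even hK hb a)).add (has_inconsistent hK hb a)
    (l := 11) (r := Odd) fun _ _ => Even.add_odd
  rw [← sum_zYX] at h₂
  have h₃ := h₁.add h₂ (l := 15) (r := Odd) fun _ _ => Even.add_odd
  convert h₃ using 1
  simp only [← Finset.sum_add_distrib]
  refine Finset.sum_congr rfl fun j _ => Finset.sum_congr rfl fun r _ => ?_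
  abel

/-- Some member of every tuple is not satisfied as a 3XOR. -/
theorem has_one_le (hK : Upsilon n m k t d c ⊆ K) (hb : Bounded n m k t d c s)
    (hk2 : Even k) [Nonempty (Var n m k t)] (a : Fin t) :
    Has s K 17 (∑ j : Fin k, ∑ r : Fin m, (var (.y a j r) - prod (.y a j r) (.u r))) (1 ≤ ·) := by
  have hk : Fintype.card (Fin k) ≤ s := by simpa using hb.k_le
  have hm : Fintype.card (Fin m) ≤ s := by simpa using hb.m_le
  have h₁ : Has s K 2 (∑ j : Fin k, ∑ r : Fin m, var (.y a j r))
      (· = (Fintype.card (Fin k) : ℤ)) := by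
    refine Has.sum_eq_card (l₁ := 1) hk fun j => ?_
    refine .of_mem (l₁ := 0) (hK (.rowY a j)) ?_ fun b hb' => ?_
    · refine (nrm_univ_sum_le _ (b := 1) (by simp)).trans ?_
      rw [mul_one]
      exact hm.trans (le_bd s 0)
    · obtain rfl : b = 1 := by simpa using hb'
      have := sixteen_le_bd s 0
      exact ⟨by rw [abs_one]; norm_cast; omega, rfl⟩
  -- Of the `k` members, `k` even, an odd number is satisfied, so an odd number is not; an odd
  -- nonnegative number is at least `1`.
  have h₂ := h₁.sub (has_satisfied_odd hK hb a) (l := 16) (r := Odd)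
    (by
      rintro _ b rfl h
      rw [Fintype.card_fin]
      exact ((Int.even_coe_nat k).2 hk2).sub_odd h)
  simp only [← Finset.sum_sub_distrib] at h₂
  have h₃ : Has s K 3
      (∑ j : Fin k, ∑ r : Fin m, (var (.y a j r) - prod (.y a j r) (.u r))) (0 ≤ ·) :=
    Has.sum_nonneg (l₁ := 2) hk fun j => Has.sum_nonneg (l₁ := 1) hm fun r =>
      (isProd_prod _ _).left.imp (by rintro _ (rfl | rfl) <;> norm_num)
  refine h₂.inter h₃ ?_
  rintro b ⟨e, rfl⟩ h
  omega

/-! ### Double counting of unsatisfied members. -/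

/-- A clause accounts for at most `d` unsatisfied members of tuples if it is not satisfied as a
3XOR, and for none otherwise. -/
theorem has_le (hK : Upsilon n m k t d c ⊆ K) (hb : Bounded n m k t d c s) (r : Fin m) :
    Has s K 8 (∑ j : Fin k, ∑ a : Fin t, (var (.y a j r) - prod (.y a j r) (.u r)) +
      ∑ _ : Fin d, var (.u r)) (· ≤ (d : ℤ)) := by
  have : Nonempty (Var n m k t) := ⟨.u r⟩
  have h16 : 16 ≤ s := Fact.out
  have hk : Fintype.card (Fin k) ≤ s := by simpa using hb.k_le
  have ht : Fintype.card (Fin t) ≤ s := by simpa using hb.t_le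
  have hd : Fintype.card (Fin d) ≤ s := by simpa using hb.d_le
  have hkt : k * t ≤ s * s := Nat.mul_le_mul hb.k_le hb.t_le
  have hbd : s ^ 3 ≤ bd s 1 := pow_le_bd (by norm_num)
  have hd' := hb.d_le
  -- The sum over `Fin d` is `d * u r`. For `u r = 0` it vanishes and `atMost` bounds the rest by
  -- `d`; for `u r = 1` it equals `d` and the rest vanishes.
  refine .cases_var (.u r) (l₁ := 7) ?_ (fun K₁ hK₁ _ hu => ?_) fun K₁ hK₁ _ hu => ?_
  · refine le_trans ?_ (bd_mono (show 1 ≤ 7 by omega))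
    have h₀ : ∀ (a : Fin t) (j : Fin k),
        nrm (var (V := Var n m k t) (.y a j r) - prod (.y a j r) (.u r)) ≤ 2 := fun a j =>
      (nrm_sub_le _ _).trans (by simp)
    have h₁ := nrm_univ_sum_le _ fun j => nrm_univ_sum_le _ fun a => h₀ a j
    have h₂ := nrm_univ_sum_le (fun _ : Fin d => var (V := Var n m k t) (.u r)) (b := 1) (by simp)
    rw [Fintype.card_fin, Fintype.card_fin] at h₁
    rw [Fintype.card_fin] at h₂
    refine (nrm_add_le _ _).trans (le_trans ?_ hbd)
    have h₃ : s * s * 16 ≤ s ^ 3 := by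
      rw [pow_succ, sq]
      exact Nat.mul_le_mul_left _ h16
    have h₄ : s * 1 ≤ s * s := Nat.mul_le_mul_left _ (by omega)
    have h₅ : k * (t * 2) = k * t * 2 := by ring
    omega
  · have h₁ : Has s K₁ 5 (∑ j : Fin k, ∑ a : Fin t, prod (.y a j r) (.u r)) (· = 0) :=
      Has.sum_eq_zero (l₁ := 4) hk fun j => Has.sum_eq_zero (l₁ := 3) ht fun a =>
        (isProd_prod _ _).symm.eq_zero hu
    have h₂ : Has s K₁ 2 (∑ j : Fin k, ∑ a : Fin t, var (.y a j r)) (· ≤ (d : ℤ)) := by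
      refine .of_mem (l₁ := 1) (hK₁ (hK (.atMost r))) ?_ fun b hb' => ?_
      · have h₁ := nrm_univ_sum_le _ fun j : Fin k => nrm_univ_sum_le
          (fun a : Fin t => var (V := Var n m k t) (.y a j r)) (b := 1) (by simp)
        rw [Fintype.card_fin, Fintype.card_fin] at h₁
        refine h₁.trans (le_trans ?_ sq_le_bd_one)
        rwa [mul_one, sq]
      · rw [Finset.mem_Icc] at hb'
        refine ⟨?_, hb'.2⟩
        rw [abs_of_nonneg hb'.1]
        refine hb'.2.trans ?_
        have := le_bd s 1
        norm_cast
        omega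
    have h₃ : Has s K₁ 2 (∑ _ : Fin d, var (.u r)) (· = 0) := Has.sum_eq_zero hd fun _ => hu
    have h₄ := h₂.sub h₁ (l := 6) (r := (· ≤ (d : ℤ))) (by rintro a _ h rfl; simpa using h)
    simp only [← Finset.sum_sub_distrib] at h₄
    exact h₄.add h₃ (by rintro a _ h rfl; simpa using h)
  · have h₁ : Has s K₁ 5 (∑ j : Fin k, ∑ a : Fin t, (var (.y a j r) - prod (.y a j r) (.u r)))
        (· = 0) :=
      Has.sum_eq_zero (l₁ := 4) hk fun j => Has.sum_eq_zero (l₁ := 3) ht fun a =>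
        (isProd_prod _ _).symm.sub_eq_zero hu
    have h₃ := Has.sum_eq_card (l := 2) hd fun _ => hu
    exact h₁.add h₃ (by rintro _ _ rfl rfl; simp)

theorem has_manySat (hK : Upsilon n m k t d c ⊆ K) (hb : Bounded n m k t d c s) (hd : 1 ≤ d) :
    Has s K 2 (∑ r : Fin m, var (.u r)) ((m : ℤ) - ⌈(t : ℚ) / (d : ℚ)⌉ + 1 ≤ ·) := by
  have h16 : 16 ≤ s := Fact.out
  have hbd := sq_le_bd_one (s := s)
  have hm := hb.m_le
  have ht := hb.t_le
  refine .of_mem (l₁ := 1) (hK .manySat) ?_ fun b hb' => ?_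
  · refine (nrm_univ_sum_le _ (b := 1) (by simp)).trans ?_
    rw [Fintype.card_fin, mul_one]
    exact hm.trans (le_bd s 1)
  · rw [Finset.mem_Icc] at hb'
    refine ⟨?_, hb'.1⟩
    -- The lower end of the interval may be negative; this keeps its absolute value within the size
    -- bound.
    have h₁ : ⌈(t : ℚ) / (d : ℚ)⌉ ≤ t := by
      rw [Int.ceil_le]
      have : (1 : ℚ) ≤ d := by exact_mod_cast hd
      rw [div_le_iff₀ (by linarith)]
      push_cast
      nlinarith [(Nat.cast_nonneg t : (0 : ℚ) ≤ t)]
    have h₂ : (s : ℤ) ≤ bd s 1 := by exact_mod_cast le_bd s 1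
    rw [abs_le]
    omega

theorem mul_ceil_lt (hd : 1 ≤ d) : (d : ℤ) * ⌈(t : ℚ) / (d : ℚ)⌉ < t + d := by
  have h := Int.ceil_lt_add_one ((t : ℚ) / (d : ℚ))
  have hd' : (0 : ℚ) < d := by exact_mod_cast hd
  have h' : (d : ℚ) * ⌈(t : ℚ) / (d : ℚ)⌉ < d * ((t : ℚ) / d + 1) := by gcongr
  rw [mul_add, mul_div_cancel₀ _ hd'.ne', mul_one] at h'
  exact_mod_cast h'

theorem has_false (hK : Upsilon n m k t d c ⊆ K) (hb : Bounded n m k t d c s) (hk2 : Even k)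
    (hd : 1 ≤ d) [Nonempty (Var n m k t)] :
    Has s K 19 (∑ a : Fin t, ∑ j : Fin k, ∑ r : Fin m,
      (var (.y a j r) - prod (.y a j r) (.u r))) fun _ => False := by
  have hm' : Fintype.card (Fin m) ≤ s := by simpa using hb.m_le
  have ht' : Fintype.card (Fin t) ≤ s := by simpa using hb.t_le
  have hd' : Fintype.card (Fin d) ≤ s := by simpa using hb.d_le
  have h₁ := Has.le_sum (l := 18) ht' (has_one_le hK hb hk2)
  have h₂ := Has.sum_le (l := 9) hm' (has_le hK hb)
  have h₃ := Has.le_sum (l := 3) hd' fun _ => has_manySat hK hb hd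
  -- The upper bound is `m d - d (m - ⌈t/d⌉ + 1) = d ⌈t/d⌉ - d`, which is below `t` by
  -- `mul_ceil_lt`.
  have h₄ := h₂.sub h₃ (l := 10) (r := (· < (t : ℤ))) fun a b ha hb => by
    have := mul_ceil_lt (t := t) hd
    simp only [Fintype.card_fin] at ha hb
    nlinarith
  have e : ∑ r : Fin m, (∑ j : Fin k, ∑ a : Fin t, (var (.y a j r) - prod (.y a j r) (.u r)) +
      ∑ _ : Fin d, var (.u r)) - ∑ _ : Fin d, ∑ r : Fin m, var (.u r) =
      ∑ a : Fin t, ∑ j : Fin k, ∑ r : Fin m,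
        (var (.y a j r) - prod (V := Var n m k t) (.y a j r) (.u r)) := by
    rw [Finset.sum_add_distrib, Finset.sum_comm (s := (Finset.univ : Finset (Fin d))),
      add_sub_cancel_right, Finset.sum_comm, Finset.sum_comm (s := (Finset.univ : Finset (Fin t)))]
    exact Finset.sum_congr rfl fun j _ => Finset.sum_comm
  rw [e] at h₄
  refine h₁.inter h₄ fun a ha ha' => ?_
  simp only [Fintype.card_fin] at ha
  omega

/-- Without variables, one of the lines is false outright. -/
theorem der_empty_of_isEmpty (hc : c = k ∨ c = 3 * k) [h : IsEmpty (Var n m k t)] :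
    Der (Upsilon n m k t d c) (bd s 19) ∅ := by
  have h16 := sixteen_le_bd s 19
  obtain rfl : m = 0 := by
    by_contra hm
    exact h.elim (.u ⟨0, by omega⟩)
  rcases Nat.eq_zero_or_pos t with rfl | ht
  -- The interval from `1` to `0` is empty, so this line is already the empty disjunction.
  · have := Line.manySat (n := n) (m := 0) (k := k) (t := 0) (d := d) (c := c)
    have h₀ : Der (Upsilon n 0 k 0 d c) _ _ := .hyp this
    simp only [Nat.cast_zero, zero_div, Int.ceil_zero, sub_zero, zero_add] at h₀
    exact h₀.mono subset_rfl (le_trans (show _ ≤ 1 from le_rfl) (by omega))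
  rcases Nat.eq_zero_or_pos k with rfl | hk
  -- There is no odd number in `{0}`, so `inconsistent` is the empty disjunction.
  · obtain rfl : c = 0 := by omega
    have := Line.inconsistent (n := n) (m := 0) (k := 0) (d := d) (c := 0) ⟨0, ht⟩
    have h₀ : Der (Upsilon n 0 0 t d 0) _ _ := .hyp this
    exact h₀.mono subset_rfl (le_trans (show _ ≤ 1 from le_rfl) (by omega))
  -- With no clauses the row sum is empty, and the line reads `0 = 1`.
  · have := Line.rowY (n := n) (m := 0) (d := d) (c := c) ⟨0, ht⟩ ⟨0, hk⟩
    have h₀ : Der (Upsilon n 0 k t d c) _ _ := .hyp this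
    rw [Finset.univ_eq_empty, Finset.sum_empty, mem_singleton, wt_eq_singleton, nrm_zero] at h₀
    refine (Der.simplify (A := ∅) one_ne_zero h₀).mono subset_rfl ?_
    have : wt (∅ : Disj (Var n 0 k t)) = 1 := rfl
    rw [this]
    simp only [Int.natAbs_one]
    omega

end ThreeXor

end

theorem theorem2 :
    ∃ p : Polynomial ℕ, ∀ n m k t d c : ℕ, Even k → 1 ≤ d → (c = k ∨ c = 3 * k) →
      ∃ π : List (RQuad.Disj (ThreeXor.Var n m k t)),
        RQuad.IsRefutation (ThreeXor.Upsilon n m k t d c) π ∧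
          RQuad.proofSize π ≤ p.eval (n + m + k + t + d) := by
  have hp : ∀ E : ℕ, ∃ p : Polynomial ℕ, ∀ x, p.eval x = (x + 16) ^ E := fun E =>
    ⟨(Polynomial.X + Polynomial.C 16) ^ E, fun x => by
      rw [Polynomial.eval_pow, Polynomial.eval_add, Polynomial.eval_X, Polynomial.eval_C]⟩
  -- `has_false` sits at level `19`, so the bound is `bd s 19` with `s` the sum of the parameters
  -- plus `16`.
  obtain ⟨p, hp⟩ := hp (100 ^ 19)
  refine ⟨p, fun n m k t d c hk hd hc => ?_⟩
  rw [hp]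
  generalize hs : n + m + k + t + d + 16 = s
  have : Fact (16 ≤ s) := ⟨by omega⟩
  have hb : ThreeXor.Bounded n m k t d c s :=
    ⟨by omega, by omega, by omega, by omega, by omega, by omega⟩
  have hder : RQuad.Der (ThreeXor.Upsilon n m k t d c) (RQuad.bd s 19) ∅ := by
    -- Sums start from `0 = 0`, whose derivation needs a variable; the variable-free case is refuted
    -- directly.
    cases isEmpty_or_nonempty (ThreeXor.Var n m k t)
    · exact ThreeXor.der_empty_of_isEmpty hc
    · exact (ThreeXor.has_false subset_rfl hb hk hd).der_empty
  obtain ⟨π, h₁, h₂, h₃⟩ := hder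
  obtain ⟨π', h₄, h₅, h₆⟩ := h₁.exists_prefix h₂
  exact ⟨π', ⟨h₄, h₅⟩, (h₆.trans (RQuad.proofSize_le_cost π)).trans h₃⟩
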